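/- Let $n\ge 2$, let $\Sigma_n$ be the complex spinor space of dimension $2^{\lfloor n/2\rfloor}$ with its Hermitian inner product and Clifford multiplication $x\otimes\gamma\mapsto x\cdot\gamma$ (vectors act by skew-Hermitian maps and $x\cdot x\cdot\gamma=-|x|^2\gamma$), and let $D\psi=\sum_{i=1}^n E_i\cdot\partial_i\psi$ be the Dirac operator on spinors $\psi:\mathbb R^n\to\Sigma_n$ of Euclidean space. For $\lambda\in\mathbb R$, a Green's function for $D-\lambda$ is a map $G_\lambda:\mathbb R^n\times\mathbb R^n\setminus\Delta\to\mathrm{End}_{\mathbb C}(\Sigma_n)$, where $\Delta$ is the diagonal, which is smooth, locally integrable on $\mathbb R^n\times\mathbb R^n$, and satisfies $$\lim_{r\to0}\int_{\mathbb R^n\setminus B_r(p)}\langle (D-\lambda)\psi(x),G_\lambda(x,p)\varphi\rangle\,dx=\langle\psi(p),\varphi\rangle$$ for all $p\in\mathbb R^n$, $\varphi\in\Sigma_n$ and all smooth compactly supported $\psi:\mathbb R^n\to\Sigma_n$. Let $\omega_{n-1}$ be the volume of the unit sphere $S^{n-1}\subset\mathbb R^n$. There are Green's functions $G_\lambda$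 for $D-\lambda$, $\lambda\in\mathbb R$, such that for every $\gamma\in\Sigma_n$ there are spinors $\vartheta_\lambda,\zeta_\lambda:\mathbb R^n\to\Sigma_n$, $\lambda\in\mathbb R$, with the following properties. For all $\lambda\in\mathbb R$ and all $x\neq0$: if $n=2$, $$G_\lambda(x,0)\gamma=-\frac1{2\pi|x|}\frac{x}{|x|}\cdot\gamma-\frac{\lambda}{2\pi}\ln|x|\,\gamma+\ln|x|\,\vartheta_\lambda(x)+\zeta_\lambda(x);$$ if $n\ge3$ is odd, $$G_\lambda(x,0)\gamma=-\frac1{\omega_{n-1}|x|^{n-1}}\frac{x}{|x|}\cdot\gamma+\frac{\lambda}{(n-2)\omega_{n-1}|x|^{n-2}}\gamma+|x|^{2-n}\zeta_\lambda(x);$$ if $n\ge4$ is even, $$G_\lambda(x,0)\gamma=-\frac1{\omega_{n-1}|x|^{n-1}}\frac{x}{|x|}\cdot\gamma+\frac{\lambda}{(n-2)\omega_{n-1}|x|^{n-2}}\gamma+|x|^{2-n}\zeta_\lambda(x)-\frac{\lambda^{n-1}}{2^{n-2}\Gamma(\frac n2)^2\omega_{n-1}}\ln|x|\,\gamma+\ln|x|\,\vartheta_\lambda(x).$$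 For every $\lambda$ the spinors $\vartheta_\lambda$ and $\zeta_\lambda$ are smooth on all of $\mathbb R^n$ and satisfy $|\vartheta_\lambda(x)|=O(|x|)$ and $|\zeta_\lambda(x)|=O(|x|)$ as $x\to0$. For every $x\in\mathbb R^n$, $\vartheta_\lambda(x)$ and $\zeta_\lambda(x)$ are power series in $\lambda$ with coefficients in $\Sigma_n$, convergent for all $\lambda\in\mathbb R$, and $\vartheta_0(x)=\zeta_0(x)=0$. -/

import Mathlib

open MeasureTheory Filter Topology Asymptotics
open scoped ContDiff

/-- Euclidean space `ℝⁿ` with its Euclidean norm. -/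
abbrev Eucl (n : ℕ) : Type := EuclideanSpace ℝ (Fin n)

/-- The spinor space `Σ_n`, a Hermitian vector space of complex dimension `2 ^ ⌊n/2⌋`.
The orthonormal basis is indexed by `{0,1}^⌊n/2⌋`. -/
abbrev Spinor (n : ℕ) : Type := EuclideanSpace ℂ (Fin (n / 2) → Bool)

/-- Flip the bit with number `⌊i/2⌋` (there is none if `n` is odd and `i = n - 1`). -/
def spinFlip {n : ℕ} (i : Fin n) (s : Fin (n / 2) → Bool) : Fin (n / 2) → Bool :=
  fun l => if l.val = i.val / 2 then !(s l) else s l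

/-- The sign `∏_{2 l < i} (-1)^{s_l}`. -/
def spinSign {n : ℕ} (i : Fin n) (s : Fin (n / 2) → Bool) : ℝ :=
  ∏ l : Fin (n / 2), if 2 * l.val < i.val ∧ s l = true then -1 else 1

/-- The nonzero matrix entries of the `i`-th Clifford generator. The sign `ε` only enters in the
last generator for odd `n`; it distinguishes the two inequivalent spinor modules in odd
dimensions. -/
noncomputable def spinPhase {n : ℕ} (ε : ℤˣ) (i : Fin n) (s : Fin (n / 2) → Bool) : ℂ :=
  if i.val % 2 = 1 then (spinSign i s : ℂ)
  else if i.val = 2 * (n / 2) then ((ε : ℤ) : ℂ) * Complex.I * (spinSign i s : ℂ)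
  else Complex.I * (spinSign i s : ℂ)

/-- Clifford multiplication `γ ↦ E_i · γ` by the `i`-th standard basis vector: up to the
factor `Complex.I` these are the usual tensor products of Pauli matrices. -/
noncomputable def cliffordGen {n : ℕ} (ε : ℤˣ) (i : Fin n) : Spinor n →L[ℂ] Spinor n :=
  LinearMap.toContinuousLinearMap
    { toFun := fun γ => WithLp.toLp 2 (fun s => spinPhase ε i s * γ (spinFlip i s))
      map_add' := by
        intro a b
        ext s
        simp [mul_add]
      map_smul' := by
        intro c a
        ext s
        simp [mul_left_comm] }

/-- Clifford multiplication `γ ↦ x · γ = ∑ i, x_i E_i · γ` on `Σ_n`. -/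
noncomputable def cliffordMul {n : ℕ} (ε : ℤˣ) (x : Eucl n) : Spinor n →L[ℂ] Spinor n :=
  ∑ i, (x i : ℂ) • cliffordGen ε i

theorem cliffordGen_apply {n : ℕ} (ε : ℤˣ) (i : Fin n) (γ : Spinor n)
    (s : Fin (n / 2) → Bool) :
    cliffordGen ε i γ s = spinPhase ε i s * γ (spinFlip i s) := rfl

theorem spinFlip_comm {n : ℕ} (i j : Fin n) (s : Fin (n / 2) → Bool) :
    spinFlip i (spinFlip j s) = spinFlip j (spinFlip i s) := by
  funext l
  simp only [spinFlip]
  split_ifs <;> rfl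

theorem spinFlip_self {n : ℕ} (i : Fin n) (s : Fin (n / 2) → Bool) :
    spinFlip i (spinFlip i s) = s := by
  funext l
  simp only [spinFlip]
  split_ifs <;> simp

theorem spinSign_sq {n : ℕ} (i : Fin n) (s : Fin (n / 2) → Bool) :
    spinSign i s * spinSign i s = 1 := by
  unfold spinSign
  rw [← Finset.prod_mul_distrib]
  apply Finset.prod_eq_one
  intro l _
  split_ifs <;> norm_num

theorem spinSign_flip_of_lt {n : ℕ} (i j : Fin n) (s : Fin (n / 2) → Bool)
    (h : 2 * (j.val / 2) < i.val) (h2 : j.val / 2 < n / 2) :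
    spinSign i (spinFlip j s) = - spinSign i s := by
  unfold spinSign
  rw [← Finset.mul_prod_erase _ _ (Finset.mem_univ (⟨j.val / 2, h2⟩ : Fin (n / 2))),
    ← Finset.mul_prod_erase (Finset.univ) (fun l : Fin (n / 2) =>
      if 2 * l.val < i.val ∧ s l = true then (-1 : ℝ) else 1)
      (Finset.mem_univ (⟨j.val / 2, h2⟩ : Fin (n / 2))), ← neg_mul]
  congr 1
  · simp only [spinFlip, h]
    cases s ⟨j.val / 2, h2⟩ <;> simp
  · apply Finset.prod_congr rfl
    intro l hl
    have : l.val ≠ j.val / 2 := by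
      intro hh
      exact (Finset.ne_of_mem_erase hl) (Fin.ext hh)
    simp [spinFlip, this]

theorem spinSign_flip_of_not_lt {n : ℕ} (i j : Fin n) (s : Fin (n / 2) → Bool)
    (h : ¬ 2 * (j.val / 2) < i.val) :
    spinSign i (spinFlip j s) = spinSign i s := by
  unfold spinSign
  apply Finset.prod_congr rfl
  intro l _
  by_cases hl : l.val = j.val / 2
  · have : ¬ 2 * l.val < i.val := by rw [hl]; exact h
    simp [this]
  · simp [spinFlip, hl]

theorem spinPhase_flip_of_lt {n : ℕ} (ε : ℤˣ) (i j : Fin n) (s : Fin (n / 2) → Bool)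
    (h : 2 * (j.val / 2) < i.val) (h2 : j.val / 2 < n / 2) :
    spinPhase ε i (spinFlip j s) = - spinPhase ε i s := by
  simp only [spinPhase, spinSign_flip_of_lt i j s h h2]
  split_ifs <;> push_cast <;> ring

theorem spinPhase_flip_of_not_lt {n : ℕ} (ε : ℤˣ) (i j : Fin n) (s : Fin (n / 2) → Bool)
    (h : ¬ 2 * (j.val / 2) < i.val) :
    spinPhase ε i (spinFlip j s) = spinPhase ε i s := by
  simp only [spinPhase, spinSign_flip_of_not_lt i j s h]

theorem spinPhase_mul_flip {n : ℕ} (ε : ℤˣ) (i : Fin n) (s : Fin (n / 2) → Bool) :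
    spinPhase ε i s * spinPhase ε i (spinFlip i s) = -1 := by
  have hs : (spinSign i s : ℂ) * (spinSign i s : ℂ) = 1 := by
    exact_mod_cast spinSign_sq i s
  have hi := i.isLt
  by_cases hodd : i.val % 2 = 1
  · rw [spinPhase_flip_of_lt ε i i s (by omega) (by omega)]
    simp only [spinPhase, hodd, if_true]
    linear_combination -hs
  · rw [spinPhase_flip_of_not_lt ε i i s (by omega)]
    have he : ((ε : ℤ) : ℂ) * ((ε : ℤ) : ℂ) = 1 := by
      exact_mod_cast Int.units_coe_mul_self ε
    simp only [spinPhase, hodd, if_false]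
    split_ifs
    · linear_combination (Complex.I * Complex.I * (spinSign i s) * (spinSign i s)) * he
        + (Complex.I * Complex.I) * hs + Complex.I_mul_I
    · linear_combination (Complex.I * Complex.I) * hs + Complex.I_mul_I

theorem conj_spinPhase {n : ℕ} (ε : ℤˣ) (i : Fin n) (s : Fin (n / 2) → Bool) :
    (starRingEnd ℂ) (spinPhase ε i s) = - spinPhase ε i (spinFlip i s) := by
  have hi := i.isLt
  by_cases hodd : i.val % 2 = 1
  · rw [spinPhase_flip_of_lt ε i i s (by omega) (by omega)]
    simp [spinPhase, hodd]
  · rw [spinPhase_flip_of_not_lt ε i i s (by omega)]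
    simp only [spinPhase, hodd, if_false]
    split_ifs <;> simp

theorem cliffordGen_anticomm {n : ℕ} (ε : ℤˣ) {i j : Fin n} (hij : i < j) (γ : Spinor n) :
    cliffordGen ε i (cliffordGen ε j γ) = - cliffordGen ε j (cliffordGen ε i γ) := by
  have hj := j.isLt
  have hij' : i.val < j.val := hij
  ext s
  simp only [cliffordGen_apply, PiLp.neg_apply]
  rw [spinPhase_flip_of_lt ε j i s (by omega) (by omega),
    spinPhase_flip_of_not_lt ε i j s (by omega), spinFlip_comm]
  ring

/-- The Clifford relations `E_i · E_j · γ + E_j · E_i · γ = - 2 δ_ij γ`. -/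
theorem cliffordGen_relation {n : ℕ} (ε : ℤˣ) (i j : Fin n) (γ : Spinor n) :
    cliffordGen ε i (cliffordGen ε j γ) + cliffordGen ε j (cliffordGen ε i γ)
      = if i = j then (-2 : ℂ) • γ else 0 := by
  rcases lt_trichotomy i j with h | h | h
  · rw [if_neg h.ne, cliffordGen_anticomm ε h, neg_add_cancel]
  · subst h
    rw [if_pos rfl]
    ext s
    simp only [cliffordGen_apply, PiLp.add_apply, PiLp.smul_apply, spinFlip_self, smul_eq_mul]
    linear_combination (2 * γ s) * spinPhase_mul_flip ε i s
  · rw [if_neg h.ne', cliffordGen_anticomm ε h, add_neg_cancel]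

/-- Clifford multiplication by `E_i` is skew-Hermitian. -/
theorem inner_cliffordGen {n : ℕ} (ε : ℤˣ) (i : Fin n) (γ δ : Spinor n) :
    inner ℂ (cliffordGen ε i γ) δ = - inner ℂ γ (cliffordGen ε i δ) := by
  simp only [PiLp.inner_apply, RCLike.inner_apply, cliffordGen_apply, map_mul]
  rw [← Finset.sum_neg_distrib]
  refine Finset.sum_bij' (fun s _ => spinFlip i s) (fun s _ => spinFlip i s)
    (by simp) (by simp) (by simp [spinFlip_self]) (by simp [spinFlip_self]) ?_
  intro s _
  rw [conj_spinPhase, spinFlip_self]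
  ring

theorem cliffordMul_single {n : ℕ} (ε : ℤˣ) (i : Fin n) :
    cliffordMul ε (EuclideanSpace.single i (1 : ℝ)) = cliffordGen ε i := by
  unfold cliffordMul
  rw [Finset.sum_eq_single i]
  · simp
  · intro j _ hj
    have h0 : ((EuclideanSpace.single i (1 : ℝ) : Eucl n) j : ℂ) = 0 := by simp [hj]
    rw [h0]
    exact zero_smul ℂ (cliffordGen ε j)
  · simp

/-- `x · (x · γ) = - |x|² γ`. -/
theorem cliffordMul_sq {n : ℕ} (ε : ℤˣ) (x : Eucl n) (γ : Spinor n) :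
    cliffordMul ε x (cliffordMul ε x γ) = (-(‖x‖ ^ 2 : ℝ) : ℂ) • γ := by
  have h1 : cliffordMul ε x (cliffordMul ε x γ)
      = ∑ i, ∑ j, ((x i : ℂ) * (x j : ℂ)) • cliffordGen ε i (cliffordGen ε j γ) := by
    rw [Finset.sum_comm]
    simp [-Complex.coe_smul, cliffordMul, map_sum, Finset.smul_sum, smul_smul, mul_comm]
  have h2 : cliffordMul ε x (cliffordMul ε x γ)
      = ∑ i, ∑ j, ((x i : ℂ) * (x j : ℂ)) • cliffordGen ε j (cliffordGen ε i γ) := by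
    rw [h1, Finset.sum_comm]
    simp only [mul_comm]
  have h3 : (2 : ℂ) • cliffordMul ε x (cliffordMul ε x γ)
      = (2 : ℂ) • ((-(‖x‖ ^ 2 : ℝ) : ℂ) • γ) := by
    rw [two_smul]
    nth_rewrite 1 [h1]
    rw [h2, ← Finset.sum_add_distrib]
    simp only [← Finset.sum_add_distrib, ← smul_add, cliffordGen_relation]
    simp only [smul_ite, smul_zero, Finset.sum_ite_eq, Finset.mem_univ, if_true, smul_smul]
    rw [← Finset.sum_smul, EuclideanSpace.norm_sq_eq]
    congr 1
    push_cast
    simp only [Real.norm_eq_abs, ← Complex.ofReal_pow, sq_abs]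
    rw [← Finset.sum_neg_distrib, Finset.mul_sum]
    apply Finset.sum_congr rfl
    intro i _
    push_cast
    ring
  exact smul_right_injective _ (two_ne_zero : (2 : ℂ) ≠ 0) h3

/-- The Dirac operator `D ψ = ∑ i, E_i · ∂_i ψ` of Euclidean space. The spinor bundle of `ℝⁿ` is
trivial with fibre `Σ_n` and its connection is the flat one, so spinors are functions
`ℝⁿ → Σ_n`. -/
noncomputable def dirac {n : ℕ} (ε : ℤˣ) (ψ : Eucl n → Spinor n) (x : Eucl n) : Spinor n :=
  ∑ i, cliffordMul ε (EuclideanSpace.single i (1 : ℝ))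
    (fderiv ℝ ψ x (EuclideanSpace.single i (1 : ℝ)))

/-- `G` is a Green's function for `D - lam` on `ℝⁿ`: it is smooth off the diagonal, locally
integrable on `ℝⁿ × ℝⁿ` (values on the diagonal, a null set, are irrelevant), and
`lim_{r → 0} ∫_{ℝⁿ ∖ B_r(p)} ⟨(D - lam) ψ, G(·, p) φ⟩ = ⟨ψ(p), φ⟩` for all `p`, `φ` and all
smooth compactly supported spinors `ψ`. -/
structure IsGreenFunction {n : ℕ} (ε : ℤˣ) (lam : ℝ)
    (G : Eucl n × Eucl n → (Spinor n →L[ℂ] Spinor n)) : Prop where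
  smooth : ContDiffOn ℝ ∞ G {q | q.1 ≠ q.2}
  locallyIntegrable : LocallyIntegrable G volume
  green : ∀ (p : Eucl n) (φ : Spinor n) (ψ : Eucl n → Spinor n),
    ContDiff ℝ ∞ ψ → HasCompactSupport ψ →
    Tendsto (fun r : ℝ => ∫ x in (Metric.ball p r)ᶜ,
        (inner ℂ (dirac ε ψ x - lam • ψ x) (G (x, p) φ) : ℂ))
      (𝓝[>] 0) (𝓝 (inner ℂ (ψ p) φ))

/-- `ω_{n-1}`, the volume of the unit sphere `S^{n-1}` in `ℝⁿ`. -/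
noncomputable def sphereVolume (n : ℕ) : ℝ :=
  (volume : Measure (Eucl n)).toSphere.real Set.univ

/-! Since `D² = -Δ`, one has `(D - l)(D + l) = -Δ - l²`. Hence, if `F` is a radial fundamental
solution of `-Δ - l²`, the spinor `(D + l)(F γ)` should be a Green's function for `D - l` with pole
at the origin. The Frobenius ansatz `F = |x|^(2-n) ∑ (a_k + b_k log |x|) (l |x|)^(2k)` gives a
two-term recursion (`greenCoeff`) whose solution decays like `C^k / k!`, so all series are entire.
In the variable `s = |x|²`, write `F = v(s)` and `u = 2 v'`; then `D(F γ) = u x · γ`, and the kernel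
is `u x · γ + l v γ` (`diracKernel`). The equation `(D - l) G = 0` off the origin becomes the
first-order system `2 v' = u`, `2 s u' + n u = -l² v` (`dirac_diracKernel`).

That this pointwise solution is a Green's function uses only its leading singularity `-x / (ω
|x|^n)` (`IsDiracKernel.isGreenFunction`). Multiply it by a smooth cutoff at scale `δ` and use the
symmetry of `D`: only the gradient of the cutoff survives. Rescaling to a fixed annulus and letting
`δ → 0` replaces the kernel by its leading term; `x · x · φ = -|x|² φ` and polar coordinates then
give exactly `⟨ψ(0), φ⟩`.

The expansion is read off the coefficients. The `k = 0` terms are the displayed powers, and the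
higher ones carry a factor `l² |x|²`. For odd `n` all `b_k` vanish. For even `n` the recursion is
resonant at `2k + 2 = n`; this creates the first logarithm, whose coefficient is explicit
(`greenCoeff_snd_critical`), and the rest of the logarithmic part carries a factor `l^n`. -/

/-! ### Entire power series with real coefficients. -/

/-- The coefficient sequences of entire power series. -/
def EntireCoeff (c : ℕ → ℝ) : Prop := ∀ R : ℝ, Summable fun k => c k * R ^ k

/-- The sum of the power series with coefficients `c`. -/
noncomputable def powSum (c : ℕ → ℝ) (t : ℝ) : ℝ := ∑' k, c k * t ^ k

namespace EntireCoeff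

variable {c d : ℕ → ℝ}

theorem hasSum (hc : EntireCoeff c) (t : ℝ) : HasSum (fun k => c k * t ^ k) (powSum c t) :=
  (hc t).hasSum

theorem of_le_pow_div_factorial {M C : ℝ} (h : ∀ k, |c k| ≤ M * (C ^ k / k.factorial)) :
    EntireCoeff c := by
  intro R
  refine Summable.of_norm_bounded
    (g := fun k => M * ((C * |R|) ^ k / k.factorial))
    ((Real.summable_pow_div_factorial _).mul_left _) fun k => ?_
  rw [norm_mul, norm_pow, Real.norm_eq_abs, Real.norm_eq_abs, mul_pow]
  calc |c k| * |R| ^ k ≤ (M * (C ^ k / k.factorial)) * |R| ^ k := by gcongr; exact h k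
    _ = _ := by ring

theorem shift (hc : EntireCoeff c) (j : ℕ) : EntireCoeff fun k => c (k + j) := by
  intro R
  rcases eq_or_ne R 0 with rfl | hR
  · refine summable_of_ne_finset_zero (s := {0}) fun k hk => ?_
    simp only [Finset.mem_singleton] at hk
    simp [hk]
  · have h := ((summable_nat_add_iff j).2 (hc R)).mul_right (R ^ j)⁻¹
    refine h.congr fun k => ?_
    have := pow_ne_zero j hR
    rw [pow_add]
    field_simp

/-- Because `k ≤ 2 ^ k`, the extra factor is absorbed by doubling the radius. -/
theorem natMul (hc : EntireCoeff c) : EntireCoeff fun k => (k : ℝ) * c k := by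
  intro R
  refine Summable.of_norm_bounded (hc (2 * |R|)).norm fun k => ?_
  have : (k : ℝ) ≤ 2 ^ k := by exact_mod_cast Nat.lt_two_pow_self.le
  simp only [norm_mul, norm_pow, Real.norm_eq_abs, abs_abs, Nat.abs_cast, Nat.abs_ofNat, mul_pow]
  calc (k : ℝ) * |c k| * |R| ^ k ≤ 2 ^ k * |c k| * |R| ^ k := by gcongr
    _ = _ := by ring

theorem deriv_coeff (hc : EntireCoeff c) : EntireCoeff fun k => ((k : ℝ) + 1) * c (k + 1) := by
  simpa using hc.natMul.shift 1

theorem hasDerivAt (hc : EntireCoeff c) (t : ℝ) :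
    HasDerivAt (powSum c) (powSum (fun k => ((k : ℝ) + 1) * c (k + 1)) t) t := by
  have hterm : ∀ (k : ℕ) (y : ℝ), HasDerivAt (fun y => c k * y ^ k)
      (c k * (k * y ^ (k - 1))) y := fun k y => (hasDerivAt_pow k y).const_mul _
  have hR : 0 < |t| + 1 := by positivity
  -- The derivatives are dominated on the ball of radius `|t| + 1`, which contains both `t` and the
  -- base point `0`; this justifies termwise differentiation.
  have hsum : Summable fun k : ℕ => |c k| * (k * (|t| + 1) ^ (k - 1)) := by
    rw [← summable_nat_add_iff 1]
    refine ((hc.deriv_coeff (|t| + 1)).norm).congr fun k => ?_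
    rw [norm_mul, norm_mul, norm_pow]
    simp only [Real.norm_eq_abs, abs_of_pos hR, add_tsub_cancel_right]
    rw [abs_of_nonneg (by positivity : (0 : ℝ) ≤ k + 1)]
    push_cast
    ring
  have h := hasDerivAt_tsum_of_isPreconnected (g := fun k y => c k * y ^ k)
    (t := Metric.ball (0 : ℝ) (|t| + 1)) (y := t) (y₀ := 0) hsum Metric.isOpen_ball
    (convex_ball _ _).isPreconnected (fun k y _ => hterm k y) (fun k y hy => ?_)
    (by simpa using hR) (hc 0) (by simp)
  · have h2 : ∑' k : ℕ, c k * (k * t ^ (k - 1))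
        = powSum (fun k => ((k : ℝ) + 1) * c (k + 1)) t := by
      have hs : Summable fun k : ℕ => c k * (k * t ^ (k - 1)) := by
        rw [← summable_nat_add_iff 1]
        refine (hc.deriv_coeff t).congr fun k => ?_
        simp only [add_tsub_cancel_right]
        push_cast
        ring
      rw [hs.tsum_eq_zero_add]
      simp only [CharP.cast_eq_zero, zero_mul, mul_zero, zero_add, add_tsub_cancel_right, powSum]
      refine tsum_congr fun k => ?_
      push_cast
      ring
    rw [h2] at h
    exact h
  · have hy' : |y| ≤ |t| + 1 := by simpa using (Metric.mem_ball.1 hy).le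
    rw [norm_mul, norm_mul, norm_pow]
    simp only [Real.norm_eq_abs, Nat.abs_cast]
    gcongr

theorem contDiff (hc : EntireCoeff c) : ContDiff ℝ ∞ (powSum c) := by
  rw [contDiff_infty]
  intro m
  induction m generalizing c with
  | zero =>
    exact contDiff_zero.2 (continuous_iff_continuousAt.2 fun t => (hc.hasDerivAt t).continuousAt)
  | succ m ih =>
    have hd : deriv (powSum c) = powSum (fun k => ((k : ℝ) + 1) * c (k + 1)) :=
      funext fun t => (hc.hasDerivAt t).deriv
    push_cast
    rw [contDiff_succ_iff_deriv]
    exact ⟨fun t => (hc.hasDerivAt t).differentiableAt, by simp, hd ▸ ih hc.deriv_coeff⟩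

theorem continuous (hc : EntireCoeff c) : Continuous (powSum c) := hc.contDiff.continuous

theorem powSum_zero (c : ℕ → ℝ) : powSum c 0 = c 0 := by
  rw [powSum, tsum_eq_single 0]
  · simp
  · intro k hk
    simp [hk]

theorem powSum_eq_add (hc : EntireCoeff c) (t : ℝ) :
    powSum c t = c 0 + t * powSum (fun k => c (k + 1)) t := by
  rw [powSum, (hc t).tsum_eq_zero_add, powSum, ← tsum_mul_left]
  simp only [pow_zero, mul_one]
  congr 1
  exact tsum_congr fun k => by ring

theorem powSum_eq_pow_mul (hc : EntireCoeff c) {j : ℕ} (h : ∀ k < j, c k = 0) (t : ℝ) :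
    powSum c t = t ^ j * powSum (fun k => c (k + j)) t := by
  rw [powSum, ← (hc t).sum_add_tsum_nat_add j, powSum, ← tsum_mul_left,
    Finset.sum_eq_zero fun k hk => by rw [h k (Finset.mem_range.1 hk), zero_mul], zero_add]
  exact tsum_congr fun k => by ring

theorem mul_powSum_deriv (hc : EntireCoeff c) (t : ℝ) :
    t * powSum (fun k => ((k : ℝ) + 1) * c (k + 1)) t = powSum (fun k => (k : ℝ) * c k) t := by
  rw [hc.natMul.powSum_eq_add]
  simp

theorem powSum_add (hc : EntireCoeff c) (hd : EntireCoeff d) (t : ℝ) :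
    powSum (fun k => c k + d k) t = powSum c t + powSum d t := by
  rw [powSum, powSum, powSum, ← (hc t).tsum_add (hd t)]
  exact tsum_congr fun k => by ring

theorem powSum_const_mul (r : ℝ) (c : ℕ → ℝ) (t : ℝ) :
    powSum (fun k => r * c k) t = r * powSum c t := by
  rw [powSum, powSum, ← tsum_mul_left]
  exact tsum_congr fun k => by ring

theorem const_mul (hc : EntireCoeff c) (r : ℝ) : EntireCoeff fun k => r * c k := fun R =>
  ((hc R).mul_left r).congr fun k => by ring

theorem add (hc : EntireCoeff c) (hd : EntireCoeff d) : EntireCoeff fun k => c k + d k := fun R =>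
  ((hc R).add (hd R)).congr fun k => by ring

end EntireCoeff

/-! ### Entire power series in the spectral parameter. -/

/-- A function of a real parameter given by an everywhere convergent power series. -/
def IsEntireSeries {E : Type*} [NormedAddCommGroup E] [NormedSpace ℝ E] (f : ℝ → E) : Prop :=
  ∃ a : ℕ → E, ∀ l : ℝ, HasSum (fun k : ℕ => l ^ k • a k) (f l)

namespace IsEntireSeries

variable {E : Type*} [NormedAddCommGroup E] [NormedSpace ℝ E] {f g : ℝ → E}

theorem add (hf : IsEntireSeries f) (hg : IsEntireSeries g) :
    IsEntireSeries fun l => f l + g l := by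
  obtain ⟨a, ha⟩ := hf
  obtain ⟨b, hb⟩ := hg
  exact ⟨fun k => a k + b k, fun l => by simpa only [smul_add] using (ha l).add (hb l)⟩

theorem param_smul (hf : IsEntireSeries f) : IsEntireSeries fun l => l • f l := by
  obtain ⟨a, ha⟩ := hf
  refine ⟨fun k => Nat.casesOn k 0 a, fun l => ?_⟩
  rw [← hasSum_nat_add_iff' 1]
  have h : l • f l - ∑ i ∈ Finset.range 1, l ^ i • (Nat.casesOn i 0 a : E) = l • f l := by simp
  rw [h]
  convert! (ha l).const_smul l using 1
  funext k
  exact (by rw [pow_succ', mul_smul] : l ^ (k + 1) • a k = l • l ^ k • a k)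

theorem param_pow_smul (hf : IsEntireSeries f) (j : ℕ) : IsEntireSeries fun l => l ^ j • f l := by
  induction j with
  | zero => simpa using hf
  | succ j ih => simpa only [pow_succ', mul_smul] using ih.param_smul

theorem powSum_smul {c : ℕ → ℝ} (hc : EntireCoeff c) (s : ℝ) (v : E) :
    IsEntireSeries fun l => powSum c (l ^ 2 * s) • v := by
  -- Only even powers of `l` occur: the coefficient of `l ^ (2 * k)` is `c k * s ^ k`.
  refine ⟨fun k => if Even k then (c (k / 2) * s ^ (k / 2)) • v else 0, fun l => ?_⟩
  change HasSum _ (powSum c (l ^ 2 * s) • v)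
  rw [← add_zero (powSum c (l ^ 2 * s) • v)]
  refine HasSum.even_add_odd ?_ ?_
  · convert! (hc.hasSum (l ^ 2 * s)).smul_const v using 1
    funext k
    simp only [even_two, Even.mul_right, if_true, smul_smul]
    congr 1
    rw [Nat.mul_div_cancel_left k two_pos, mul_pow, pow_mul]
    ring
  · simp

end IsEntireSeries

/-! ### Frobenius coefficients of the radial Helmholtz equation. -/

/-- The pairs `(a k, b k)` such that `|x| ^ (2 - n) * ∑ k, (a k + b k * log |x|) * (lam |x|) ^ (2 k)`
is a fundamental solution of `-Δ - lam ^ 2` on `ℝⁿ`, where `w` is the area of the unit sphere. -/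
noncomputable def greenCoeff (n : ℕ) (w : ℝ) : ℕ → ℝ × ℝ
  | 0 => if n = 2 then (0, -1 / w) else (1 / ((n - 2) * w), 0)
  | k + 1 =>
    -- Resonance: with `j = k + 1`, the Laplacian sends `r^(2-n+2j)` to `q r^(2-n+2j-2)` and
    -- `r^(2-n+2j) log r` to `(q log r + 4j + 2 - n) r^(2-n+2j-2)`, where `q = 2j(2j + 2 - n)`. When
    -- `q = 0` the logarithmic coefficient must absorb the previous power term (and `4j + 2 - n =
    -- 2j`), while the power coefficient is free and is set to `0`.
    if 2 * (k + 1) + 2 = n then (0, -(greenCoeff n w k).1 / (2 * (k + 1)))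
    else
      let q : ℝ := 2 * (k + 1) * (2 * (k + 1) + 2 - n)
      let b : ℝ := -(greenCoeff n w k).2 / q
      (-((greenCoeff n w k).1 + (4 * (k + 1) + 2 - n) * b) / q, b)

section

variable {n : ℕ} {w : ℝ}

/-- This is the leading coefficient of the radial derivative, hence the flux through small spheres;
it treats the logarithmic case `n = 2` and the power case uniformly. -/
theorem greenCoeff_leading (hw : w ≠ 0) :
    (2 - n : ℝ) * (greenCoeff n w 0).1 + (greenCoeff n w 0).2 = -1 / w := by
  rw [greenCoeff]
  split_ifs with h
  · simp
  · have : (n : ℝ) - 2 ≠ 0 := sub_ne_zero.2 (by exact_mod_cast h)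
    field_simp
    ring

theorem greenCoeff_zero_snd : (2 - n : ℝ) * (greenCoeff n w 0).2 = 0 := by
  rw [greenCoeff]
  split_ifs with h
  · simp [h]
  · simp

theorem greenCoeff_snd_eq_zero {k : ℕ} (h : 2 * k + 2 < n) : (greenCoeff n w k).2 = 0 := by
  induction k with
  | zero =>
    rw [greenCoeff, if_neg (by omega)]
  | succ k ih =>
    rw [greenCoeff, if_neg (by omega)]
    simp [ih (by omega)]

theorem greenCoeff_snd_eq_zero_of_odd (hn : Odd n) (k : ℕ) : (greenCoeff n w k).2 = 0 := by
  obtain ⟨m, rfl⟩ := hn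
  induction k with
  | zero => rw [greenCoeff, if_neg (by omega)]
  | succ k ih =>
    rw [greenCoeff, if_neg (by omega)]
    simp [ih]

theorem two_mul_add_two_sub_ne_zero {k : ℕ} (h : 2 * (k + 1) + 2 ≠ n) :
    (2 * ((k : ℝ) + 1) + 2 - n) ≠ 0 := by
  rw [sub_ne_zero]
  exact_mod_cast h

/-- The division-free form includes the resonant index, where the left factor vanishes and no
logarithm has yet appeared on the right. -/
theorem greenCoeff_snd_succ (k : ℕ) :
    2 * ((k : ℝ) + 1) * ((2 * (k + 1) + 2 - n) * (greenCoeff n w (k + 1)).2)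
      = -(greenCoeff n w k).2 := by
  rw [greenCoeff]
  split_ifs with h
  · have : (2 * ((k : ℝ) + 1) + 2 - n) = 0 := by rw [← h]; push_cast; ring
    rw [this, greenCoeff_snd_eq_zero (by omega)]
    simp
  · have h1 := two_mul_add_two_sub_ne_zero h
    have h2 : (k : ℝ) + 1 ≠ 0 := by positivity
    simp only
    generalize 2 * ((k : ℝ) + 1) + 2 - n = q at *
    field_simp

/-- The grouping anticipates the first-order system: the inner combinations are the coefficients of
the derivative profile, `vectorCoeff` and `vectorLogCoeff`. -/
theorem greenCoeff_fst_succ (k : ℕ) :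
    2 * ((k : ℝ) + 1) * ((2 * (k + 1) + 2 - n) * (greenCoeff n w (k + 1)).1
        + (greenCoeff n w (k + 1)).2)
      + (2 * (k + 1) + 2 - n) * (greenCoeff n w (k + 1)).2 = -(greenCoeff n w k).1 := by
  rw [greenCoeff]
  split_ifs with h
  · have h1 : (2 * ((k : ℝ) + 1) + 2 - n) = 0 := by rw [← h]; push_cast; ring
    have h2 : (k : ℝ) + 1 ≠ 0 := by positivity
    rw [h1]
    field_simp
    simp
  · have h1 := two_mul_add_two_sub_ne_zero h
    have h2 : (k : ℝ) + 1 ≠ 0 := by positivity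
    have h3 : 4 * ((k : ℝ) + 1) + 2 - n = 2 * (k + 1) + 2 - n + 2 * (k + 1) := by ring
    simp only [h3]
    generalize 2 * ((k : ℝ) + 1) + 2 - n = q at *
    field_simp
    ring

/-- Off resonance `2(k + 1) + 2 - n` is a nonzero integer, so the divisor is at least `2(k + 1)` in
absolute value. The numerator `4(k + 1) + 2 - n` costs one factor `k + 1`, but it multiplies a
quantity already divided twice, so each step gains `1 / (k + 1)` and iteration gives a factorial
bound. -/
theorem abs_greenCoeff_succ_le (k : ℕ) :
    |(greenCoeff n w (k + 1)).1| + |(greenCoeff n w (k + 1)).2|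
      ≤ (n + 8) / (k + 1) * (|(greenCoeff n w k).1| + |(greenCoeff n w k).2|) := by
  have hk : (0 : ℝ) < k + 1 := by positivity
  have hn0 : (0 : ℝ) ≤ n := by positivity
  set a := (greenCoeff n w k).1 with ha
  set b := (greenCoeff n w k).2 with hb
  rw [greenCoeff]
  split_ifs with h
  · rw [← ha]
    simp only [abs_zero, zero_add, abs_div, abs_neg]
    rw [abs_of_pos (by positivity : (0 : ℝ) < 2 * (k + 1)), div_mul_eq_mul_div,
      div_le_div_iff₀ (by positivity) hk]
    nlinarith [abs_nonneg a, abs_nonneg b, mul_nonneg hn0 (abs_nonneg a),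
      mul_nonneg hn0 (abs_nonneg b), mul_nonneg hk.le (abs_nonneg a),
      mul_nonneg hk.le (mul_nonneg hn0 (abs_nonneg a)),
      mul_nonneg hk.le (mul_nonneg hn0 (abs_nonneg b)), mul_nonneg hk.le (abs_nonneg b)]
  · rw [← ha, ← hb]
    have h1 : (1 : ℝ) ≤ |2 * ((k : ℝ) + 1) + 2 - n| := by
      have : (1 : ℤ) ≤ |2 * ((k : ℤ) + 1) + 2 - n| :=
        Int.one_le_abs (by omega)
      exact_mod_cast this
    have hq : 2 * ((k : ℝ) + 1) ≤ |2 * ((k : ℝ) + 1) * (2 * ((k : ℝ) + 1) + 2 - n)| := by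
      rw [abs_mul, abs_of_pos (by positivity : (0 : ℝ) < 2 * (k + 1))]
      nlinarith
    set q := 2 * ((k : ℝ) + 1) * (2 * ((k : ℝ) + 1) + 2 - n) with hqdef
    have hdiv : ∀ y : ℝ, |y / q| ≤ |y| / (2 * (k + 1)) := fun y => by
      rw [abs_div]
      gcongr
    have hβ : |-b / q| ≤ |b| / (2 * (k + 1)) := by simpa using hdiv (-b)
    have hc : |4 * ((k : ℝ) + 1) + 2 - n| ≤ (n + 6) * (k + 1) := by
      rw [abs_le]
      constructor <;> nlinarith [mul_nonneg hn0 hk.le, (by positivity : (0 : ℝ) ≤ n * k),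
        (by positivity : (0 : ℝ) ≤ (k : ℝ))]
    have hα : |-(a + (4 * (k + 1) + 2 - n) * (-b / q)) / q|
        ≤ (|a| + (n + 6) * (k + 1) * (|b| / (2 * (k + 1)))) / (2 * (k + 1)) := by
      refine (hdiv _).trans ?_
      rw [abs_neg]
      gcongr
      refine (abs_add_le _ _).trans ?_
      rw [abs_mul]
      gcongr
    refine (add_le_add hα hβ).trans ?_
    have : (|a| + (n + 6) * (k + 1) * (|b| / (2 * (k + 1)))) / (2 * (k + 1))
        + |b| / (2 * (k + 1)) = (2 * |a| + (n + 8) * |b|) / 4 / (k + 1) := by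
      field_simp
      ring
    rw [this, div_mul_eq_mul_div]
    gcongr
    nlinarith [abs_nonneg a, abs_nonneg b, mul_nonneg hn0 (abs_nonneg a),
      mul_nonneg hn0 (abs_nonneg b)]

theorem abs_greenCoeff_le (k : ℕ) :
    |(greenCoeff n w k).1| + |(greenCoeff n w k).2|
      ≤ (|(greenCoeff n w 0).1| + |(greenCoeff n w 0).2|)
        * (((n : ℝ) + 8) ^ k / k.factorial) := by
  induction k with
  | zero => simp
  | succ k ih =>
    refine (abs_greenCoeff_succ_le k).trans ?_
    calc _ ≤ ((n : ℝ) + 8) / (k + 1) * ((|(greenCoeff n w 0).1| + |(greenCoeff n w 0).2|)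
        * (((n : ℝ) + 8) ^ k / k.factorial)) := by gcongr
      _ = _ := by
        rw [Nat.factorial_succ]
        push_cast
        field_simp
        try ring

theorem entireCoeff_greenCoeff_fst : EntireCoeff fun k => (greenCoeff n w k).1 :=
  .of_le_pow_div_factorial fun k =>
    (le_add_of_nonneg_right (abs_nonneg _)).trans (abs_greenCoeff_le k)

theorem entireCoeff_greenCoeff_snd : EntireCoeff fun k => (greenCoeff n w k).2 :=
  .of_le_pow_div_factorial fun k =>
    (le_add_of_nonneg_left (abs_nonneg _)).trans (abs_greenCoeff_le k)

/-- Below resonance there are no logarithms and the recursion reduces to `a_{k+1} = a_k / (4 (k + 1)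
(m - 1 - k))`. Writing `w / w` in place of `1` keeps the identity true at `w = 0`. -/
theorem greenCoeff_fst_closed {m k : ℕ} (hk : k < m) :
    (greenCoeff (2 * m + 2) w k).1 * (4 ^ k * k.factorial * (m - 1).factorial * (2 * m * w))
      = (m - 1 - k).factorial * (w / w) := by
  have hm0 : (m : ℝ) ≠ 0 := by
    have : 0 < m := by omega
    positivity
  induction k with
  | zero =>
    rw [greenCoeff, if_neg (by omega)]
    push_cast
    simp only [pow_zero, Nat.factorial_zero, Nat.cast_one, one_mul, Nat.sub_zero]
    rcases eq_or_ne w 0 with rfl | hw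
    · simp
    · have : 2 * (m : ℝ) + 2 - 2 = 2 * m := by ring
      rw [this]
      field_simp
  | succ k ih =>
    have ih := ih (by omega)
    obtain ⟨j, rfl⟩ : ∃ j, m = k + 2 + j := ⟨m - (k + 2), by omega⟩
    have h1 : k + 2 + j - 1 - k = j + 1 := by omega
    have h2 : k + 2 + j - 1 - (k + 1) = j := by omega
    rw [h1, Nat.factorial_succ] at ih
    rw [h2]
    have hb : (greenCoeff (2 * (k + 2 + j) + 2) w (k + 1)).2 = 0 :=
      greenCoeff_snd_eq_zero (by omega)
    have hrec := greenCoeff_fst_succ (n := 2 * (k + 2 + j) + 2) (w := w) k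
    rw [hb] at hrec
    push_cast at hrec ih ⊢
    rw [Nat.factorial_succ, pow_succ]
    push_cast
    have hj : (j : ℝ) + 1 ≠ 0 := by positivity
    apply mul_left_cancel₀ hj
    linear_combination ih + (-(4 ^ k * k.factorial * (k + 2 + j - 1).factorial
      * (2 * ((k : ℝ) + 2 + j) * w)) : ℝ) * hrec

/-- For `m > 0` the resonant step gives `b_m = -a_{m-1} / (2m)`, and `a_{m-1}` is the last value
covered by the closed form; for `m = 0` it is the initial value. -/
theorem greenCoeff_snd_critical (hw : w ≠ 0) (m : ℕ) :
    (greenCoeff (2 * m + 2) w m).2 = -(1 / (4 ^ m * m.factorial ^ 2 * w)) := by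
  cases m with
  | zero =>
    rw [greenCoeff, if_pos rfl]
    simp [neg_div]
  | succ m =>
    have h := greenCoeff_fst_closed (w := w) (Nat.lt_succ_self m)
    rw [div_self hw] at h
    simp only [Nat.succ_eq_add_one, add_tsub_cancel_right, tsub_self, Nat.factorial_zero,
      Nat.cast_one, mul_one] at h
    rw [greenCoeff, if_pos rfl, Nat.factorial_succ]
    push_cast at h ⊢
    have h1 : (4 ^ m * m.factorial * m.factorial * (2 * ((m : ℝ) + 1) * w)) ≠ 0 := by positivity
    rw [eq_div_of_mul_eq h1 h]
    have := pow_ne_zero m (four_ne_zero (α := ℝ))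
    field_simp
    ring

end

/-! ### Radial profiles in the variable `s = |x|²`. -/

/-- The function `s ^ p * (c (l² s) + (log s / 2) * d (l² s))` for entire power series `c`, `d`. -/
noncomputable def radialProfile (p : ℝ) (c d : ℕ → ℝ) (l s : ℝ) : ℝ :=
  s ^ p * (powSum c (l ^ 2 * s) + Real.log s / 2 * powSum d (l ^ 2 * s))

section radialProfile

variable {p : ℝ} {c d : ℕ → ℝ} {l s : ℝ}

/-- The profiles are closed under `d/ds`: differentiating `s^(p+k) (c_k + d_k log s / 2)` lowers the
exponent by one and acts on the pairs `(c_k, d_k)` by a triangular map. -/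
theorem hasDerivAt_radialProfile (hc : EntireCoeff c) (hd : EntireCoeff d) (hs : 0 < s) :
    HasDerivAt (radialProfile p c d l)
      (radialProfile (p - 1) (fun k => p * c k + k * c k + 2⁻¹ * d k)
        (fun k => p * d k + k * d k) l s) s := by
  have hlin : HasDerivAt (fun s : ℝ => l ^ 2 * s) (l ^ 2) s := by
    simpa using (hasDerivAt_id s).const_mul (l ^ 2)
  have h1 := (hc.hasDerivAt (l ^ 2 * s)).comp s hlin
  have h2 := (hd.hasDerivAt (l ^ 2 * s)).comp s hlin
  have h3 := (Real.hasDerivAt_log hs.ne').div_const 2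
  have h4 := Real.hasDerivAt_rpow_const (p := p) (Or.inl hs.ne')
  have h := h4.mul (h1.add (h3.mul h2))
  convert! h using 1
  simp only [radialProfile, Function.comp_apply, Pi.add_apply, Pi.mul_apply]
  rw [((hc.const_mul p).add hc.natMul).powSum_add (hd.const_mul _),
    (hc.const_mul p).powSum_add hc.natMul, (hd.const_mul p).powSum_add hd.natMul,
    ← hc.mul_powSum_deriv, ← hd.mul_powSum_deriv]
  simp only [EntireCoeff.powSum_const_mul]
  have hp : s ^ p = s ^ (p - 1) * s := by
    rw [Real.rpow_sub_one hs.ne']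
    field_simp
  rw [hp]
  field_simp
  ring

theorem mul_radialProfile (hs : 0 < s) :
    s * radialProfile p c d l s = radialProfile (p + 1) c d l s := by
  rw [radialProfile, radialProfile, Real.rpow_add_one hs.ne']
  ring

theorem radialProfile_add {c' d' : ℕ → ℝ} (hc : EntireCoeff c) (hd : EntireCoeff d)
    (hc' : EntireCoeff c') (hd' : EntireCoeff d') :
    radialProfile p (fun k => c k + c' k) (fun k => d k + d' k) l s
      = radialProfile p c d l s + radialProfile p c' d' l s := by
  rw [radialProfile, radialProfile, radialProfile, hc.powSum_add hc', hd.powSum_add hd']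
  ring

theorem radialProfile_const_mul (r : ℝ) :
    radialProfile p (fun k => r * c k) (fun k => r * d k) l s
      = r * radialProfile p c d l s := by
  rw [radialProfile, radialProfile, EntireCoeff.powSum_const_mul, EntireCoeff.powSum_const_mul]
  ring

theorem radialProfile_shift (hc : EntireCoeff c) (hd : EntireCoeff d) (hc0 : c 0 = 0)
    (hd0 : d 0 = 0) (hs : 0 < s) :
    radialProfile p c d l s
      = l ^ 2 * radialProfile (p + 1) (fun k => c (k + 1)) (fun k => d (k + 1)) l s := by
  rw [radialProfile, radialProfile, hc.powSum_eq_add, hd.powSum_eq_add, hc0, hd0,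
    Real.rpow_add_one hs.ne']
  ring

theorem contDiffAt_radialProfile (hc : EntireCoeff c) (hd : EntireCoeff d) (hs : s ≠ 0) :
    ContDiffAt ℝ ∞ (radialProfile p c d l) s := by
  have hlin : ContDiffAt ℝ ∞ (fun s : ℝ => l ^ 2 * s) s := by fun_prop
  have h1 : ContDiffAt ℝ ∞ (fun s : ℝ => powSum c (l ^ 2 * s)) s :=
    hc.contDiff.contDiffAt.comp s hlin
  have h2 : ContDiffAt ℝ ∞ (fun s : ℝ => powSum d (l ^ 2 * s)) s :=
    hd.contDiff.contDiffAt.comp s hlin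
  exact (contDiffAt_id.rpow_const_of_ne hs).mul
    (h1.add (((Real.contDiffAt_log.2 hs).div_const 2).mul h2))

end radialProfile

/-! ### Clifford multiplication and the Dirac operator on radial spinors. -/

section clifford

variable {n : ℕ} (ε : ℤˣ)

theorem cliffordMul_apply (x : Eucl n) (γ : Spinor n) :
    cliffordMul ε x γ = ∑ i, x i • cliffordGen ε i γ := by
  simp [cliffordMul]

/-- Clifford multiplication as a continuous linear map in the vector. -/
noncomputable def cliffordCLM : Eucl n →L[ℝ] (Spinor n →L[ℂ] Spinor n) :=
  LinearMap.toContinuousLinearMap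
    { toFun := cliffordMul ε
      map_add' := by
        intro x y
        ext1 γ
        simp only [cliffordMul_apply, PiLp.add_apply, add_smul, Finset.sum_add_distrib,
          add_apply]
      map_smul' := by
        intro r x
        ext1 γ
        simp only [cliffordMul_apply, PiLp.smul_apply, smul_eq_mul, mul_smul, Finset.smul_sum,
          smul_apply, RingHom.id_apply] }

theorem cliffordMul_smul (r : ℝ) (x : Eucl n) :
    cliffordMul ε (r • x) = r • cliffordMul ε x := (cliffordCLM ε).map_smul r x

theorem cliffordMul_neg_inner (x : Eucl n) (γ δ : Spinor n) :
    inner ℂ (cliffordMul ε x γ) δ = -inner ℂ γ (cliffordMul ε x δ) := by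
  simp only [cliffordMul, sum_apply, sum_inner, inner_sum,
    smul_apply, inner_smul_left, inner_smul_right, inner_cliffordGen,
    Complex.conj_ofReal, mul_neg, Finset.sum_neg_distrib]

theorem inner_cliffordMul_cliffordMul (x : Eucl n) (γ δ : Spinor n) :
    inner ℂ (cliffordMul ε x γ) (cliffordMul ε x δ) = (‖x‖ ^ 2 : ℝ) * inner ℂ γ δ := by
  rw [cliffordMul_neg_inner, cliffordMul_sq, inner_smul_right]
  push_cast
  ring

theorem norm_cliffordMul_apply (x : Eucl n) (γ : Spinor n) :
    ‖cliffordMul ε x γ‖ = ‖x‖ * ‖γ‖ := by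
  have h : ((‖cliffordMul ε x γ‖ ^ 2 : ℝ) : ℂ) = ((‖x‖ * ‖γ‖) ^ 2 : ℝ) := by
    have h1 := inner_cliffordMul_cliffordMul ε x γ γ
    rw [inner_self_eq_norm_sq_to_K, inner_self_eq_norm_sq_to_K] at h1
    push_cast at h1 ⊢
    rw [mul_pow]
    exact h1
  have h' : ‖cliffordMul ε x γ‖ ^ 2 = (‖x‖ * ‖γ‖) ^ 2 := by exact_mod_cast h
  exact (sq_eq_sq₀ (norm_nonneg _) (by positivity)).1 h'

theorem norm_cliffordMul_le (x : Eucl n) : ‖cliffordMul ε x‖ ≤ ‖x‖ :=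
  ContinuousLinearMap.opNorm_le_bound _ (norm_nonneg _) fun γ => (norm_cliffordMul_apply ε x γ).le

end clifford

section dirac

variable {n : ℕ} (ε : ℤˣ)

theorem dirac_eq (ψ : Eucl n → Spinor n) (x : Eucl n) :
    dirac ε ψ x = ∑ i, cliffordGen ε i (fderiv ℝ ψ x (EuclideanSpace.single i (1 : ℝ))) := by
  simp only [dirac, cliffordMul_single]

theorem dirac_add {v w : Eucl n → Spinor n} {x : Eucl n} (hv : DifferentiableAt ℝ v x)
    (hw : DifferentiableAt ℝ w x) :
    dirac ε (fun y => v y + w y) x = dirac ε v x + dirac ε w x := by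
  simp only [dirac_eq, fderiv_fun_add hv hw, add_apply, map_add,
    Finset.sum_add_distrib]

theorem dirac_const (φ : Spinor n) (x : Eucl n) : dirac ε (fun _ => φ) x = 0 := by
  simp [dirac_eq]

/-- The derivative of `y · φ` in direction `i` is `E_i · φ`, and each of the `n` terms `E_i · E_i ·
φ` equals `-φ`. -/
theorem dirac_cliffordMul (φ : Spinor n) (x : Eucl n) :
    dirac ε (fun y => cliffordMul ε y φ) x = -(n : ℝ) • φ := by
  have h : HasFDerivAt (fun y => cliffordMul ε y φ)
      ((ContinuousLinearMap.apply ℝ (Spinor n) φ).comp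
        ((ContinuousLinearMap.restrictScalarsL ℂ (Spinor n) (Spinor n) ℝ ℝ).comp
          (cliffordCLM ε))) x :=
    ContinuousLinearMap.hasFDerivAt
      ((ContinuousLinearMap.apply ℝ (Spinor n) φ).comp
        ((ContinuousLinearMap.restrictScalarsL ℂ (Spinor n) (Spinor n) ℝ ℝ).comp
          (cliffordCLM ε)))
  rw [dirac_eq, h.fderiv]
  have hi : ∀ i : Fin n, cliffordGen ε i (cliffordGen ε i φ) = (-1 : ℝ) • φ := fun i => by
    have h2 := cliffordMul_sq ε (EuclideanSpace.single i (1 : ℝ)) φ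
    rw [cliffordMul_single] at h2
    rw [h2]
    simp
  have : ∀ i : Fin n, ((ContinuousLinearMap.apply ℝ (Spinor n) φ).comp
        ((ContinuousLinearMap.restrictScalarsL ℂ (Spinor n) (Spinor n) ℝ ℝ).comp
          (cliffordCLM ε))) (EuclideanSpace.single i (1 : ℝ)) = cliffordGen ε i φ := fun i => by
    change cliffordMul ε (EuclideanSpace.single i (1 : ℝ)) φ = _
    rw [cliffordMul_single]
  simp only [this, hi]
  rw [Finset.sum_const, Finset.card_univ, Fintype.card_fin, ← Nat.cast_smul_eq_nsmul ℝ, smul_smul]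
  simp

/-- Leibniz rule: the gradient of `f(|y|²)` is `2 f' y`, and it acts by Clifford multiplication. -/
theorem dirac_radial_smul {f : ℝ → ℝ} {f' : ℝ} {w : Eucl n → Spinor n} {x : Eucl n}
    (hf : HasDerivAt f f' (‖x‖ ^ 2)) (hw : DifferentiableAt ℝ w x) :
    dirac ε (fun y => f (‖y‖ ^ 2) • w y) x
      = (2 * f') • cliffordMul ε x (w x) + f (‖x‖ ^ 2) • dirac ε w x := by
  have h1 : HasFDerivAt (fun y : Eucl n => f (‖y‖ ^ 2)) (f' • (2 • innerSL ℝ x)) x :=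
    hf.comp_hasFDerivAt x (hasStrictFDerivAt_norm_sq x).hasFDerivAt
  rw [dirac_eq, dirac_eq, (h1.fun_smul hw.hasFDerivAt).fderiv, cliffordMul_apply]
  simp only [Finset.smul_sum]
  rw [← Finset.sum_add_distrib]
  refine Finset.sum_congr rfl fun i _ => ?_
  simp only [add_apply, smul_apply, map_add,
    ContinuousLinearMap.smulRight_apply, innerSL_apply_apply,
    ContinuousLinearMap.map_smul_of_tower]
  rw [add_comm]
  congr 1
  rw [smul_smul]
  congr 1
  simp [EuclideanSpace.inner_single_right]
  ring

end dirac

/-! ### Dirac kernels and their local integrability. -/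

/-- A field on `ℝⁿ`, smooth off the origin, with the leading singularity of a Green's function of
a Dirac operator and annihilated by `D - l` off the origin. -/
structure IsDiracKernel {n : ℕ} (ε : ℤˣ) (l : ℝ) (g : Eucl n → (Spinor n →L[ℂ] Spinor n)) :
    Prop where
  smooth : ContDiffOn ℝ ∞ g {0}ᶜ
  leading : Tendsto (fun x : Eucl n =>
    ‖x‖ ^ (n - 1) • g x + (1 / sphereVolume n) • cliffordMul ε (‖x‖⁻¹ • x)) (𝓝[≠] 0) (𝓝 0)
  dirac_eq : ∀ (φ : Spinor n) (x : Eucl n), x ≠ 0 → dirac ε (fun y => g y φ) x = l • g x φ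

theorem sphereVolume_eq (n : ℕ) [NeZero n] :
    sphereVolume n = n * (volume : Measure (Eucl n)).real (Metric.ball 0 1) := by
  rw [sphereVolume, Measure.toSphere_real_apply_univ, finrank_euclideanSpace_fin]

theorem sphereVolume_pos {n : ℕ} (hn : n ≠ 0) : 0 < sphereVolume n := by
  have : NeZero n := ⟨hn⟩
  rw [sphereVolume_eq]
  have h1 : 0 < (volume : Measure (Eucl n)).real (Metric.ball 0 1) :=
    ENNReal.toReal_pos (Metric.measure_ball_pos _ _ one_pos).ne' measure_ball_lt_top.ne
  have : 0 < n := Nat.pos_of_ne_zero hn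
  positivity

/-- On a product of two balls, `f (x - y)` agrees with the integrand of the convolution of the
ball's indicator with a truncation of `f`; that integrand is integrable on the whole product. The
truncation radius `R + R` covers all differences of points of the balls. -/
theorem locallyIntegrable_sub {m : ℕ} {E : Type*} [NormedAddCommGroup E] [NormedSpace ℝ E]
    {f : Eucl m → E} (hf : LocallyIntegrable f volume) :
    LocallyIntegrable (fun q : Eucl m × Eucl m => f (q.1 - q.2)) volume := by
  rintro ⟨x, y⟩
  set R : ℝ := ‖x‖ + ‖y‖ + 1 with hRdef
  have hR : 0 < R := by positivity
  have h1 : Integrable ((Metric.closedBall (0 : Eucl m) (R + R)).indicator f) volume :=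
    (hf.integrableOn_isCompact (isCompact_closedBall _ _)).integrable_indicator
      measurableSet_closedBall
  have h2 : Integrable ((Metric.ball (0 : Eucl m) R).indicator fun _ => (1 : ℝ)) volume :=
    (integrableOn_const (C := (1 : ℝ)) measure_ball_lt_top.ne).integrable_indicator
      measurableSet_ball
  have h := h2.convolution_integrand (ContinuousLinearMap.lsmul ℝ ℝ) h1
  refine ⟨Metric.ball 0 R ×ˢ Metric.ball 0 R, prod_mem_nhds
    (Metric.isOpen_ball.mem_nhds ?_) (Metric.isOpen_ball.mem_nhds ?_), ?_⟩
  · rw [mem_ball_zero_iff]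
    linarith [norm_nonneg y]
  · rw [mem_ball_zero_iff]
    linarith [norm_nonneg x]
  · rw [Measure.volume_eq_prod]
    refine (h.integrableOn (s := Metric.ball 0 R ×ˢ Metric.ball 0 R)).congr_fun ?_
      (measurableSet_ball.prod measurableSet_ball)
    rintro ⟨a, b⟩ ⟨ha, hb⟩
    have hab : a - b ∈ Metric.closedBall (0 : Eucl m) (R + R) := by
      rw [mem_ball_zero_iff] at ha hb
      rw [mem_closedBall_zero_iff]
      exact (norm_sub_le _ _).trans (add_le_add ha.le hb.le)
    change b ∈ _ at hb
    change ContinuousLinearMap.lsmul ℝ ℝ ((Metric.ball (0 : Eucl m) R).indicator _ b)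
      ((Metric.closedBall (0 : Eucl m) (R + R)).indicator f (a - b)) = f (a - b)
    rw [Set.indicator_of_mem hab, Set.indicator_of_mem hb, ContinuousLinearMap.lsmul_apply,
      one_smul]

namespace IsDiracKernel

variable {n : ℕ} {ε : ℤˣ} {l : ℝ} {g : Eucl n → (Spinor n →L[ℂ] Spinor n)}

theorem bound (hg : IsDiracKernel ε l g) :
    ∃ C : ℝ, 0 ≤ C ∧ ∃ r : ℝ, 0 < r ∧ ∀ x : Eucl n, x ≠ 0 → ‖x‖ < r →
      ‖x‖ ^ (n - 1) * ‖g x‖ ≤ C := by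
  have h := (tendsto_zero_iff_norm_tendsto_zero.1 hg.leading).eventually_lt_const one_pos
  rw [eventually_nhdsWithin_iff, Metric.eventually_nhds_iff] at h
  obtain ⟨r, hr, h⟩ := h
  -- The `1` bounds the remainder in `leading` near the origin, and the other summand bounds the
  -- leading term itself.
  refine ⟨1 + |1 / sphereVolume n|, by positivity, r, hr, fun x hx hxr => ?_⟩
  have h1 := h (by simpa using hxr) hx
  have h2 : ‖(1 / sphereVolume n) • cliffordMul ε (‖x‖⁻¹ • x)‖ ≤ |1 / sphereVolume n| := by
    rw [norm_smul, Real.norm_eq_abs]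
    refine mul_le_of_le_one_right (abs_nonneg _) ((norm_cliffordMul_le _ _).trans ?_)
    rw [norm_smul, norm_inv, norm_norm, inv_mul_cancel₀ (norm_ne_zero_iff.2 hx)]
  have h3 : ‖‖x‖ ^ (n - 1) • g x‖ = ‖x‖ ^ (n - 1) * ‖g x‖ := by
    rw [norm_smul, norm_pow, norm_norm]
  rw [← h3]
  have h4 := norm_sub_le (‖x‖ ^ (n - 1) • g x + (1 / sphereVolume n) • cliffordMul ε (‖x‖⁻¹ • x))
    ((1 / sphereVolume n) • cliffordMul ε (‖x‖⁻¹ • x))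
  rw [add_sub_cancel_right] at h4
  linarith

theorem aestronglyMeasurable (hg : IsDiracKernel ε l g) [NeZero n] :
    AEStronglyMeasurable g volume := by
  have h := hg.smooth.continuousOn.aestronglyMeasurable (μ := volume)
    (measurableSet_singleton (0 : Eucl n)).compl
  rwa [restrict_compl_singleton] at h

theorem locallyIntegrable (hg : IsDiracKernel ε l g) [NeZero n] :
    LocallyIntegrable g volume := by
  intro x
  rcases eq_or_ne x 0 with rfl | hx
  · obtain ⟨C, hC, r, hr, h⟩ := hg.bound
    refine ⟨Metric.ball 0 r, Metric.ball_mem_nhds _ hr, ?_⟩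
    have hint : IntegrableOn (fun x : Eucl n => C * (‖x‖ ^ (n - 1))⁻¹) (Metric.ball 0 r) := by
      -- In polar coordinates the Jacobian `y ^ (n - 1)` cancels the singularity.
      refine (integrableOn_fun_norm_addHaar volume (f := fun y : ℝ => C * (y ^ (n - 1))⁻¹)).2 ?_
      rw [finrank_euclideanSpace_fin]
      refine (integrableOn_const (C := C) (by simp)).congr_fun (fun y hy => ?_) measurableSet_Ioo
      have := pow_ne_zero (n - 1) hy.1.ne'
      simp only [smul_eq_mul]
      field_simp
    refine Integrable.mono' hint hg.aestronglyMeasurable.restrict ?_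
    filter_upwards [ae_restrict_mem Metric.isOpen_ball.measurableSet,
      ae_restrict_of_ae (Measure.ae_ne volume (0 : Eucl n))] with x hxr hx
    have hpos : 0 < ‖x‖ ^ (n - 1) := pow_pos (norm_pos_iff.2 hx) _
    rw [← div_eq_mul_inv, le_div_iff₀ hpos, mul_comm]
    exact h x hx (by simpa using hxr)
  · have h := hg.smooth.continuousOn.integrableAt_nhdsWithin (μ := volume)
      (measurableSet_singleton (0 : Eucl n)).compl hx
    rwa [isOpen_compl_singleton.nhdsWithin_eq hx] at h

end IsDiracKernel

/-! ### Symmetry of the Dirac operator. -/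

section symmetry

variable {n : ℕ} (ε : ℤˣ)

theorem continuous_dirac {ψ : Eucl n → Spinor n} (hψ : ContDiff ℝ 1 ψ) :
    Continuous (dirac ε ψ) := by
  have h := hψ.continuous_fderiv one_ne_zero
  change Continuous fun x => dirac ε ψ x
  simp only [dirac_eq]
  exact continuous_finsetSum _ fun i _ =>
    (cliffordGen ε i).continuous.comp (h.clm_apply continuous_const)

theorem hasCompactSupport_dirac {ψ : Eucl n → Spinor n} (hψ : HasCompactSupport ψ) :
    HasCompactSupport (dirac ε ψ) := by
  refine (hψ.fderiv (𝕜 := ℝ)).mono fun x hx => ?_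
  contrapose! hx
  rw [Function.notMem_support] at hx ⊢
  simp [dirac_eq, hx]

theorem integral_fderiv_apply_eq_zero {h : Eucl n → ℂ} (hh : ContDiff ℝ 1 h)
    (hc : HasCompactSupport h) (v : Eucl n) : ∫ x, fderiv ℝ h x v = 0 := by
  have hcont : Continuous fun x => fderiv ℝ h x v :=
    (hh.continuous_fderiv one_ne_zero).clm_apply continuous_const
  have hsupp : HasCompactSupport fun x => fderiv ℝ h x v := hc.fderiv_apply (𝕜 := ℝ) v
  have := integral_bilinear_hasLineDerivAt_right_eq_neg_left_of_integrable
    (μ := (volume : Measure (Eucl n))) (f := h) (f' := fun x => fderiv ℝ h x v)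
    (g := fun _ => (1 : ℂ)) (g' := fun _ => 0) (v := v) (B := ContinuousLinearMap.mul ℝ ℂ)
    (by simpa using hcont.integrable_of_hasCompactSupport hsupp) (by simp)
    (by simpa using hh.continuous.integrable_of_hasCompactSupport hc)
    (fun x _ => ((hh.differentiable one_ne_zero) x).hasFDerivAt.hasLineDerivAt v)
    (fun x _ => by simpa using (hasFDerivAt_const (𝕜 := ℝ) (1 : ℂ) x).hasLineDerivAt v)
  simpa using this

/-- As each `E_i` is skew-Hermitian, `⟨Dψ, w⟩ - ⟨ψ, Dw⟩` is the divergence `∑ ∂_i ⟨E_i · ψ, w⟩`,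
which is compactly supported and integrates to zero. -/
theorem integral_inner_dirac {ψ w : Eucl n → Spinor n} (hψ : ContDiff ℝ 1 ψ)
    (hc : HasCompactSupport ψ) (hw : ContDiff ℝ 1 w) :
    ∫ x, inner ℂ (dirac ε ψ x) (w x) = ∫ x, inner ℂ (ψ x) (dirac ε w x) := by
  have hsub : ∀ i : Fin n, HasCompactSupport fun x => cliffordGen ε i (ψ x) := fun i =>
    hc.comp_left (map_zero _)
  have hsmooth : ∀ i : Fin n, ContDiff ℝ 1 fun x => cliffordGen ε i (ψ x) := fun i =>
    ((cliffordGen ε i).restrictScalars ℝ).contDiff.comp hψ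
  have hC : ∀ i : Fin n, ContDiff ℝ 1 fun x => (inner ℂ (cliffordGen ε i (ψ x)) (w x) : ℂ) :=
    fun i => (hsmooth i).inner ℂ hw
  have hS : ∀ i : Fin n,
      HasCompactSupport fun x => (inner ℂ (cliffordGen ε i (ψ x)) (w x) : ℂ) := fun i =>
    (hsub i).mono fun x hx => by
      contrapose! hx
      rw [Function.notMem_support] at hx ⊢
      rw [hx, inner_zero_left]
  have hD : ∀ (i : Fin n) (x : Eucl n),
      fderiv ℝ (fun x => (inner ℂ (cliffordGen ε i (ψ x)) (w x) : ℂ)) x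
          (EuclideanSpace.single i 1)
        = inner ℂ (cliffordGen ε i (fderiv ℝ ψ x (EuclideanSpace.single i 1))) (w x)
          - inner ℂ (ψ x) (cliffordGen ε i (fderiv ℝ w x (EuclideanSpace.single i 1))) := by
    intro i x
    have h1 : HasFDerivAt (fun x => cliffordGen ε i (ψ x))
        (((cliffordGen ε i).restrictScalars ℝ).comp (fderiv ℝ ψ x)) x :=
      ((cliffordGen ε i).restrictScalars ℝ).hasFDerivAt.comp x
        (hψ.differentiable one_ne_zero x).hasFDerivAt
    rw [fderiv_inner_apply ℂ h1.differentiableAt (hw.differentiable one_ne_zero x), h1.fderiv,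
      inner_cliffordGen ε i (ψ x)]
    simp only [ContinuousLinearMap.comp_apply, ContinuousLinearMap.coe_restrictScalars']
    ring
  have hint : ∀ i : Fin n, Integrable fun x =>
      fderiv ℝ (fun x => (inner ℂ (cliffordGen ε i (ψ x)) (w x) : ℂ)) x
          (EuclideanSpace.single i 1) := fun i =>
    (((hC i).continuous_fderiv one_ne_zero).clm_apply
      continuous_const).integrable_of_hasCompactSupport ((hS i).fderiv_apply (𝕜 := ℝ) _)
  have hsum : ∫ x, (inner ℂ (dirac ε ψ x) (w x) - inner ℂ (ψ x) (dirac ε w x) : ℂ) = 0 := by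
    have : ∀ x, (inner ℂ (dirac ε ψ x) (w x) - inner ℂ (ψ x) (dirac ε w x) : ℂ)
        = ∑ i, fderiv ℝ (fun x => (inner ℂ (cliffordGen ε i (ψ x)) (w x) : ℂ)) x
          (EuclideanSpace.single i 1) := fun x => by
      simp only [hD, Finset.sum_sub_distrib, dirac_eq, sum_inner, inner_sum]
    simp only [this]
    rw [integral_finsetSum _ fun i _ => hint i]
    exact Finset.sum_eq_zero fun i _ => integral_fderiv_apply_eq_zero (hC i) (hS i) _
  rw [integral_sub] at hsum
  · exact sub_eq_zero.1 hsum
  · refine ((continuous_dirac ε hψ).inner hw.continuous).integrable_of_hasCompactSupport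
      ((hasCompactSupport_dirac ε hc).mono fun x hx => ?_)
    contrapose! hx
    rw [Function.notMem_support] at hx ⊢
    rw [hx, inner_zero_left]
  · refine (hψ.continuous.inner (continuous_dirac ε hw)).integrable_of_hasCompactSupport
      (hc.mono fun x hx => ?_)
    contrapose! hx
    rw [Function.notMem_support] at hx ⊢
    rw [hx, inner_zero_left]

end symmetry

/-! ### The smooth cutoff and its total radial derivative. -/

section cutoff

theorem continuous_deriv_smoothTransition : Continuous (deriv Real.smoothTransition) :=
  (Real.smoothTransition.contDiff (n := 1)).continuous_deriv le_rfl

theorem deriv_smoothTransition_of_neg {t : ℝ} (ht : t < 0) :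
    deriv Real.smoothTransition t = 0 := by
  have h : Real.smoothTransition =ᶠ[𝓝 t] fun _ => 0 := by
    filter_upwards [Iio_mem_nhds ht] with s hs
    exact Real.smoothTransition.zero_of_nonpos (le_of_lt hs)
  rw [h.deriv_eq, deriv_const]

theorem deriv_smoothTransition_of_one_lt {t : ℝ} (ht : 1 < t) :
    deriv Real.smoothTransition t = 0 := by
  have h : Real.smoothTransition =ᶠ[𝓝 t] fun _ => 1 := by
    filter_upwards [Ioi_mem_nhds ht] with s hs
    exact Real.smoothTransition.one_of_one_le (le_of_lt hs)
  rw [h.deriv_eq, deriv_const]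

theorem exists_abs_deriv_smoothTransition_le :
    ∃ C : ℝ, 0 ≤ C ∧ ∀ t, |deriv Real.smoothTransition t| ≤ C := by
  obtain ⟨C, hC⟩ := (isCompact_Icc (a := (0 : ℝ)) (b := 1)).exists_bound_of_continuousOn
    continuous_deriv_smoothTransition.continuousOn
  refine ⟨max C 0, le_max_right _ _, fun t => ?_⟩
  rcases lt_or_ge t 0 with h | h
  · simp [deriv_smoothTransition_of_neg h]
  rcases lt_or_ge 1 t with h1 | h1
  · simp [deriv_smoothTransition_of_one_lt h1]
  · exact (hC t ⟨h, h1⟩).trans (le_max_left _ _)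

theorem hasDerivAt_smoothTransition (t : ℝ) :
    HasDerivAt Real.smoothTransition (deriv Real.smoothTransition t) t :=
  ((Real.smoothTransition.contDiff (n := 1)).differentiable one_ne_zero t).hasDerivAt

theorem integral_deriv_smoothTransition_sq :
    ∫ r in Set.Ioi (0 : ℝ), 2 * r * deriv Real.smoothTransition (r ^ 2 - 1) = 1 := by
  have hd : ∀ r : ℝ, HasDerivAt (fun r : ℝ => Real.smoothTransition (r ^ 2 - 1))
      (2 * r * deriv Real.smoothTransition (r ^ 2 - 1)) r := fun r => by
    have h1 : HasDerivAt (fun r : ℝ => r ^ 2 - 1) (2 * r) r := by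
      simpa using (hasDerivAt_pow 2 r).sub_const 1
    convert! (hasDerivAt_smoothTransition (r ^ 2 - 1)).comp r h1 using 1
    ring
  have hcont : Continuous fun r : ℝ => 2 * r * deriv Real.smoothTransition (r ^ 2 - 1) :=
    (continuous_const.mul continuous_id).mul
      (continuous_deriv_smoothTransition.comp (by fun_prop))
  have hsupp : HasCompactSupport fun r : ℝ => 2 * r * deriv Real.smoothTransition (r ^ 2 - 1) := by
    refine HasCompactSupport.intro (isCompact_Icc (a := (-2 : ℝ)) (b := 2)) fun r hr => ?_
    have : 4 < r ^ 2 := by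
      rw [Set.mem_Icc, not_and_or, not_le, not_le] at hr
      rcases hr with h | h <;> nlinarith
    rw [deriv_smoothTransition_of_one_lt (by linarith), mul_zero]
  have hlim : Tendsto (fun r : ℝ => Real.smoothTransition (r ^ 2 - 1)) atTop (𝓝 1) := by
    refine tendsto_const_nhds.congr' ?_
    filter_upwards [eventually_ge_atTop 2] with r hr
    rw [Real.smoothTransition.one_of_one_le (by nlinarith)]
  rw [integral_Ioi_of_hasDerivAt_of_tendsto' (fun r _ => hd r)
    (hcont.integrable_of_hasCompactSupport hsupp).integrableOn hlim,
    Real.smoothTransition.zero_of_nonpos (by norm_num), sub_zero]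

/-- This integral fixes the normalisation of the Green's function: the cutoff rises from `0` to `1`
along every ray, so only the area of the sphere remains. -/
theorem integral_radial_deriv_smoothTransition (n : ℕ) [NeZero n] :
    ∫ y : Eucl n, 2 * deriv Real.smoothTransition (‖y‖ ^ 2 - 1) * (‖y‖ * (‖y‖ ^ (n - 1))⁻¹)
      = sphereVolume n := by
  rw [integral_fun_norm_addHaar volume
    (fun r : ℝ => 2 * deriv Real.smoothTransition (r ^ 2 - 1) * (r * (r ^ (n - 1))⁻¹)),
    finrank_euclideanSpace_fin]
  have : ∫ r in Set.Ioi (0 : ℝ), r ^ (n - 1) •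
        (2 * deriv Real.smoothTransition (r ^ 2 - 1) * (r * (r ^ (n - 1))⁻¹))
      = ∫ r in Set.Ioi (0 : ℝ), 2 * r * deriv Real.smoothTransition (r ^ 2 - 1) := by
    refine setIntegral_congr_fun measurableSet_Ioi fun r hr => ?_
    have := pow_ne_zero (n - 1) (ne_of_gt (Set.mem_Ioi.1 hr))
    simp only [smul_eq_mul]
    field_simp
  rw [this, integral_deriv_smoothTransition_sq, sphereVolume_eq]
  simp

end cutoff

/-! ### From the leading singularity to the weak equation. -/

namespace IsDiracKernel

variable {n : ℕ} {ε : ℤˣ} {l : ℝ} {g : Eucl n → (Spinor n →L[ℂ] Spinor n)}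

theorem contDiffAt_apply (hg : IsDiracKernel ε l g) (φ : Spinor n) {x : Eucl n} (hx : x ≠ 0) :
    ContDiffAt ℝ ∞ (fun y => g y φ) x := by
  have h := hg.smooth.contDiffAt (isOpen_compl_singleton.mem_nhds hx)
  exact ((ContinuousLinearMap.apply ℝ (Spinor n) φ).comp
    (ContinuousLinearMap.restrictScalarsL ℂ (Spinor n) (Spinor n) ℝ ℝ)).contDiff.contDiffAt.comp x h

theorem locallyIntegrable_norm (hg : IsDiracKernel ε l g) [NeZero n] :
    LocallyIntegrable (fun x => ‖g x‖) volume := fun x =>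
  let ⟨s, hs, h⟩ := hg.locallyIntegrable x
  ⟨s, hs, h.norm⟩

theorem integrable_inner (hg : IsDiracKernel ε l g) [NeZero n] {u : Eucl n → Spinor n}
    (hu : Continuous u) (hc : HasCompactSupport u) (φ : Spinor n) :
    Integrable fun x => (inner ℂ (u x) (g x φ) : ℂ) := by
  have h1 : Integrable fun x => ‖u x‖ • ‖g x‖ :=
    (locallyIntegrable_norm hg).integrable_smul_left_of_hasCompactSupport hu.norm hc.norm
  have hm : AEStronglyMeasurable (fun x => g x φ) volume := by
    have h : ContinuousOn (fun x => g x φ) {0}ᶜ := fun x hx =>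
      (hg.contDiffAt_apply φ hx).continuousAt.continuousWithinAt
    have h := h.aestronglyMeasurable (μ := volume) (measurableSet_singleton (0 : Eucl n)).compl
    rwa [restrict_compl_singleton] at h
  refine (h1.mul_const ‖φ‖).mono' (hu.aestronglyMeasurable.inner hm) (.of_forall fun x => ?_)
  refine (norm_inner_le_norm _ _).trans ?_
  rw [smul_eq_mul, mul_assoc]
  gcongr
  exact (g x).le_opNorm φ

/-- Multiplying a test spinor by a cutoff at scale `δ` reduces the weak equation to an integral
over a fixed annulus. -/
theorem integral_cutoff (hg : IsDiracKernel ε l g) [NeZero n] {ψ : Eucl n → Spinor n}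
    (hψ : ContDiff ℝ 1 ψ) (hc : HasCompactSupport ψ) (φ : Spinor n) {δ : ℝ} (hδ : 0 < δ) :
    ∫ x, Real.smoothTransition ((δ ^ 2)⁻¹ * ‖x‖ ^ 2 - 1) •
        (inner ℂ (dirac ε ψ x - l • ψ x) (g x φ) : ℂ)
      = ∫ y, (inner ℂ (ψ (δ • y)) ((2 * deriv Real.smoothTransition (‖y‖ ^ 2 - 1)) •
          cliffordMul ε y ((δ ^ (n - 1) • g (δ • y)) φ)) : ℂ) := by
  have hδ2 : 0 < (δ ^ 2)⁻¹ := by positivity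
  set f : ℝ → ℝ := fun s => Real.smoothTransition ((δ ^ 2)⁻¹ * s - 1) with hf
  set f' : ℝ → ℝ := fun s => (δ ^ 2)⁻¹ * deriv Real.smoothTransition ((δ ^ 2)⁻¹ * s - 1) with hf'
  set w : Eucl n → Spinor n := fun x => f (‖x‖ ^ 2) • g x φ with hw
  have hfd : ∀ s, HasDerivAt f (f' s) s := fun s => by
    have h1 : HasDerivAt (fun s : ℝ => (δ ^ 2)⁻¹ * s - 1) (δ ^ 2)⁻¹ s := by
      simpa using ((hasDerivAt_id s).const_mul (δ ^ 2)⁻¹).sub_const 1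
    convert! (hasDerivAt_smoothTransition ((δ ^ 2)⁻¹ * s - 1)).comp s h1 using 1
    rw [mul_comm]
  have hfC : ContDiff ℝ 1 f :=
    (Real.smoothTransition.contDiff (n := 1)).comp (by fun_prop)
  -- The cutoff removes a neighbourhood of the singularity, so `w` is `C¹` everywhere and can be
  -- used in the symmetry of `D`.
  have hw0 : w =ᶠ[𝓝 0] fun _ => 0 := by
    have hcont : Continuous fun x : Eucl n => (δ ^ 2)⁻¹ * ‖x‖ ^ 2 - 1 := by fun_prop
    have h0 : (δ ^ 2)⁻¹ * ‖(0 : Eucl n)‖ ^ 2 - 1 < 0 := by simp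
    filter_upwards [(hcont.tendsto 0).eventually_lt_const h0] with x hx
    rw [hw, hf]
    simp only
    rw [Real.smoothTransition.zero_of_nonpos hx.le, zero_smul]
  have hwC : ContDiff ℝ 1 w := by
    rw [contDiff_iff_contDiffAt]
    intro x
    rcases eq_or_ne x 0 with rfl | hx
    · exact contDiffAt_const.congr_of_eventuallyEq hw0
    · exact (hfC.comp (contDiff_norm_sq ℝ)).contDiffAt.smul
        ((hg.contDiffAt_apply φ hx).of_le (by exact_mod_cast le_top))
  -- Since `D - l` annihilates the kernel off the origin, only the gradient of the cutoff
  -- contributes.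
  have hDw : ∀ x, dirac ε w x - l • w x = (2 * f' (‖x‖ ^ 2)) • cliffordMul ε x (g x φ) := by
    intro x
    rcases eq_or_ne x 0 with rfl | hx
    · have h1 : fderiv ℝ w 0 = 0 := by rw [hw0.fderiv_eq]; simp
      have h2 : w 0 = 0 := hw0.eq_of_nhds
      have h3 : f' (‖(0 : Eucl n)‖ ^ 2) = 0 := by
        simp only [hf', norm_zero]
        rw [deriv_smoothTransition_of_neg (by norm_num), mul_zero]
      rw [_root_.dirac_eq, h1, h2, h3]
      simp
    · rw [hw, dirac_radial_smul ε (hfd _)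
        ((hg.contDiffAt_apply φ hx).differentiableAt (by simp)), hg.dirac_eq φ x hx,
        smul_comm l, add_sub_cancel_right]
  have hψD : Continuous (dirac ε ψ) := continuous_dirac ε hψ
  have hi1 : Integrable fun x => (inner ℂ (dirac ε ψ x) (w x) : ℂ) := by
    refine (hψD.inner hwC.continuous).integrable_of_hasCompactSupport
      ((hasCompactSupport_dirac ε hc).mono fun x hx => ?_)
    contrapose! hx
    rw [Function.notMem_support] at hx ⊢
    rw [hx, inner_zero_left]
  have hi : ∀ v : Eucl n → Spinor n, Continuous v →
      Integrable fun x => (inner ℂ (ψ x) (v x) : ℂ) := fun v hv => by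
    refine (hψ.continuous.inner hv).integrable_of_hasCompactSupport
      (hc.mono fun x hx => ?_)
    contrapose! hx
    rw [Function.notMem_support] at hx ⊢
    rw [hx, inner_zero_left]
  have hstep : ∫ x, f (‖x‖ ^ 2) • (inner ℂ (dirac ε ψ x - l • ψ x) (g x φ) : ℂ)
      = ∫ x, (inner ℂ (ψ x) ((2 * f' (‖x‖ ^ 2)) • cliffordMul ε x (g x φ)) : ℂ) := by
    calc _ = ∫ x, ((inner ℂ (dirac ε ψ x) (w x) : ℂ) - inner ℂ (ψ x) (l • w x)) := by
          refine integral_congr_ae (.of_forall fun x => ?_)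
          simp only [hw, inner_sub_left, inner_smul_left_eq_smul, inner_smul_right_eq_smul, smul_sub]
          rw [smul_comm l]
      _ = ∫ x, (inner ℂ (ψ x) (dirac ε w x - l • w x) : ℂ) := by
          have hl : Continuous fun x => l • w x := hwC.continuous.const_smul l
          rw [integral_sub hi1 (hi _ hl), integral_inner_dirac ε hψ hc hwC,
            ← integral_sub (hi _ (continuous_dirac ε hwC)) (hi _ hl)]
          simp only [inner_sub_right]
      _ = _ := by simp only [hDw]
  rw [hstep]
  -- Substitute `x = δ y`: the Jacobian `δ ^ n`, the factor `(δ ^ 2)⁻¹` in `f'` and the `δ` from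
  -- Clifford multiplication by `x` combine to `δ ^ (n - 1)`.
  have hscale := Measure.integral_comp_smul_of_nonneg (volume : Measure (Eucl n))
    (fun x => (inner ℂ (ψ x) ((2 * f' (‖x‖ ^ 2)) • cliffordMul ε x (g x φ)) : ℂ)) δ (hR := hδ.le)
  rw [finrank_euclideanSpace_fin] at hscale
  have hδn : δ ^ n ≠ 0 := by positivity
  rw [eq_inv_smul_iff₀ hδn] at hscale
  rw [← hscale, ← integral_smul]
  refine integral_congr_ae (.of_forall fun y => ?_)
  have h1 : (δ ^ 2)⁻¹ * ‖δ • y‖ ^ 2 - 1 = ‖y‖ ^ 2 - 1 := by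
    rw [norm_smul, Real.norm_of_nonneg hδ.le]
    field_simp
  simp only [hf', h1, cliffordMul_smul, smul_apply, ContinuousLinearMap.map_smul_of_tower]
  rw [← inner_smul_right_eq_smul]
  congr 1
  simp only [smul_smul]
  congr 1
  obtain ⟨m, rfl⟩ := Nat.exists_eq_succ_of_ne_zero (NeZero.ne n)
  simp only [Nat.succ_eq_add_one, add_tsub_cancel_right]
  field_simp
  ring

end IsDiracKernel

theorem continuousOn_cliffordMul_apply {n : ℕ} (ε : ℤˣ) {v : Eucl n → Spinor n}
    {s : Set (Eucl n)} (hv : ContinuousOn v s) :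
    ContinuousOn (fun y => cliffordMul ε y (v y)) s := by
  simp only [cliffordMul_apply]
  refine continuousOn_finsetSum _ fun i _ => ?_
  have hi : Continuous fun y : Eucl n => y i := by fun_prop
  exact hi.continuousOn.smul ((cliffordGen ε i).continuous.comp_continuousOn hv)

namespace IsDiracKernel

variable {n : ℕ} {ε : ℤˣ} {l : ℝ} {g : Eucl n → (Spinor n →L[ℂ] Spinor n)}

/-- The leading term is homogeneous of degree `1 - n`, so this rescaling fixes it and sends the
remainder to zero. -/
theorem tendsto_scale (hg : IsDiracKernel ε l g) {y : Eucl n} (hy : y ≠ 0) :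
    Tendsto (fun δ : ℝ => δ ^ (n - 1) • g (δ • y)) (𝓝[>] 0)
      (𝓝 (-((‖y‖ ^ (n - 1))⁻¹ * (1 / sphereVolume n)) • cliffordMul ε (‖y‖⁻¹ • y))) := by
  have hy0 : ‖y‖ ≠ 0 := norm_ne_zero_iff.2 hy
  have hlim : Tendsto (fun δ : ℝ => δ • y) (𝓝[>] 0) (𝓝[≠] 0) := by
    refine tendsto_nhdsWithin_iff.2 ⟨?_, ?_⟩
    · have : Continuous fun δ : ℝ => δ • y := by fun_prop
      simpa using (this.tendsto 0).mono_left nhdsWithin_le_nhds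
    · filter_upwards [self_mem_nhdsWithin] with δ hδ
      exact smul_ne_zero (ne_of_gt (Set.mem_Ioi.1 hδ)) hy
  have h := ((hg.leading.comp hlim).sub_const
    ((1 / sphereVolume n) • cliffordMul ε (‖y‖⁻¹ • y))).const_smul (‖y‖ ^ (n - 1))⁻¹
  rw [zero_sub, smul_neg, smul_smul] at h
  have hneg : ∀ (a : ℝ) (T : Spinor n →L[ℂ] Spinor n), -(a • T) = (-a) • T := fun a T =>
    (neg_smul a T).symm
  rw [hneg] at h
  refine h.congr' ?_
  filter_upwards [self_mem_nhdsWithin] with δ hδ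
  have hδ : 0 < δ := hδ
  have h1 : ‖δ • y‖⁻¹ • δ • y = ‖y‖⁻¹ • y := by
    rw [norm_smul, Real.norm_of_nonneg hδ.le, smul_smul]
    congr 1
    field_simp
  simp only [Function.comp_apply, h1, add_sub_cancel_right]
  rw [norm_smul, Real.norm_of_nonneg hδ.le, smul_smul, mul_pow]
  congr 1
  field_simp

theorem tendsto_integral_annulus (hg : IsDiracKernel ε l g) [NeZero n] {ψ : Eucl n → Spinor n}
    (hψ : ContDiff ℝ 1 ψ) (hc : HasCompactSupport ψ) (φ : Spinor n) :
    Tendsto (fun δ : ℝ => ∫ y, (inner ℂ (ψ (δ • y))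
        ((2 * deriv Real.smoothTransition (‖y‖ ^ 2 - 1)) •
          cliffordMul ε y ((δ ^ (n - 1) • g (δ • y)) φ)) : ℂ))
      (𝓝[>] 0) (𝓝 (inner ℂ (ψ 0) φ)) := by
  obtain ⟨C, hC0, r, hr, hC⟩ := hg.bound
  obtain ⟨T, hT0, hT⟩ := exists_abs_deriv_smoothTransition_le
  obtain ⟨P, hP⟩ := hc.exists_bound_of_continuous hψ.continuous
  have hP0 : 0 ≤ P := (norm_nonneg _).trans (hP 0)
  have hω := sphereVolume_pos (NeZero.ne n)
  -- The two Clifford multiplications collapse by `y · y · φ = -|y|² φ`; the remaining scalar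
  -- integral is `sphereVolume n`, which cancels the normalisation.
  have hlim : ∫ y, (inner ℂ (ψ 0) ((2 * deriv Real.smoothTransition (‖y‖ ^ 2 - 1)) •
        cliffordMul ε y ((-((‖y‖ ^ (n - 1))⁻¹ * (1 / sphereVolume n)) •
          cliffordMul ε (‖y‖⁻¹ • y)) φ)) : ℂ) = inner ℂ (ψ 0) φ := by
    have : ∀ y : Eucl n, (inner ℂ (ψ 0) ((2 * deriv Real.smoothTransition (‖y‖ ^ 2 - 1)) •
        cliffordMul ε y ((-((‖y‖ ^ (n - 1))⁻¹ * (1 / sphereVolume n)) •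
          cliffordMul ε (‖y‖⁻¹ • y)) φ)) : ℂ)
        = (2 * deriv Real.smoothTransition (‖y‖ ^ 2 - 1) * (‖y‖ * (‖y‖ ^ (n - 1))⁻¹)) •
          ((1 / sphereVolume n) • (inner ℂ (ψ 0) φ : ℂ)) := fun y => by
      have h1 : ((-(‖y‖ ^ 2 : ℝ) : ℂ)) • φ = (-(‖y‖ ^ 2)) • φ := by
        rw [← Complex.coe_smul]
        push_cast
        rfl
      rw [smul_apply, cliffordMul_smul, smul_apply,
        ContinuousLinearMap.map_smul_of_tower, ContinuousLinearMap.map_smul_of_tower,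
        cliffordMul_sq, h1, smul_smul, smul_smul, smul_smul, inner_smul_right_eq_smul, smul_smul]
      congr 1
      rcases eq_or_ne ‖y‖ 0 with h | h
      · simp [h]
      · field_simp
    simp only [this]
    rw [integral_smul_const, integral_radial_deriv_smoothTransition, smul_smul,
      mul_one_div_cancel hω.ne', one_smul]
  rw [← hlim]
  -- The integrand lives on `1 ≤ |y|² ≤ 2`. The factors of the dominating constant bound, in turn,
  -- `ψ`, twice the derivative of the cutoff, `|y|`, and the rescaled kernel applied to `φ`.
  refine tendsto_integral_filter_of_dominated_convergence
    ((Metric.ball (0 : Eucl n) 2).indicator fun _ => P * (2 * T * (2 * (C * ‖φ‖)))) ?_ ?_ ?_ ?_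
  · filter_upwards [self_mem_nhdsWithin] with δ hδ
    have hδ : δ ≠ 0 := ne_of_gt (Set.mem_Ioi.1 hδ)
    refine AEStronglyMeasurable.inner
      (hψ.continuous.comp (continuous_const_smul δ)).aestronglyMeasurable ?_
    have hcont : ContinuousOn (fun y : Eucl n =>
        (2 * deriv Real.smoothTransition (‖y‖ ^ 2 - 1)) •
          cliffordMul ε y ((δ ^ (n - 1) • g (δ • y)) φ)) {0}ᶜ := by
      have h1 : Continuous fun y : Eucl n => 2 * deriv Real.smoothTransition (‖y‖ ^ 2 - 1) :=
        continuous_const.mul (continuous_deriv_smoothTransition.comp (by fun_prop))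
      have h2 : ContinuousOn (fun y : Eucl n => (δ ^ (n - 1) • g (δ • y)) φ) {0}ᶜ := by
        have h3 : ContinuousOn (fun y : Eucl n => g y φ) {0}ᶜ := fun y hy =>
          (hg.contDiffAt_apply φ hy).continuousAt.continuousWithinAt
        have h4 : ContinuousOn (fun y : Eucl n => g (δ • y) φ) {0}ᶜ :=
          h3.comp (continuous_const_smul δ).continuousOn fun y hy => smul_ne_zero hδ hy
        exact h4.const_smul (δ ^ (n - 1))
      exact h1.continuousOn.smul (continuousOn_cliffordMul_apply ε h2)
    have h := hcont.aestronglyMeasurable (μ := volume) (measurableSet_singleton (0 : Eucl n)).compl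
    rwa [restrict_compl_singleton] at h
  · filter_upwards [Ioo_mem_nhdsGT (half_pos hr)] with δ hδ
    refine .of_forall fun y => ?_
    rcases lt_or_ge (‖y‖ ^ 2 - 1) 0 with hy | hy
    · rw [deriv_smoothTransition_of_neg hy, mul_zero, zero_smul, inner_zero_right, norm_zero]
      exact Set.indicator_nonneg (fun _ _ => by positivity) _
    rcases lt_or_ge 1 (‖y‖ ^ 2 - 1) with hy1 | hy1
    · rw [deriv_smoothTransition_of_one_lt hy1, mul_zero, zero_smul, inner_zero_right, norm_zero]
      exact Set.indicator_nonneg (fun _ _ => by positivity) _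
    have hge : 1 ≤ ‖y‖ := by nlinarith [norm_nonneg y]
    have hlt : ‖y‖ < 2 := by nlinarith [norm_nonneg y]
    have hy0 : y ≠ 0 := by
      rintro rfl
      simp at hge
      linarith
    rw [Set.indicator_of_mem (by simpa using hlt)]
    have hgb : ‖δ ^ (n - 1) • g (δ • y)‖ ≤ C := by
      rw [norm_smul, norm_pow, Real.norm_of_nonneg hδ.1.le]
      refine le_trans ?_ (hC (δ • y) (smul_ne_zero hδ.1.ne' hy0) ?_)
      · rw [norm_smul, Real.norm_of_nonneg hδ.1.le, mul_pow]
        refine mul_le_mul_of_nonneg_right ?_ (norm_nonneg _)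
        exact le_mul_of_one_le_right (pow_nonneg hδ.1.le _) (one_le_pow₀ hge)
      · rw [norm_smul, Real.norm_of_nonneg hδ.1.le]
        nlinarith [hδ.1, hδ.2]
    refine (norm_inner_le_norm _ _).trans ?_
    rw [norm_smul, norm_mul, norm_cliffordMul_apply]
    simp only [Real.norm_eq_abs, Nat.abs_ofNat]
    gcongr
    · exact hP _
    · exact hT _
    · exact (ContinuousLinearMap.le_opNorm _ _).trans (by gcongr)
  · exact (integrableOn_const measure_ball_lt_top.ne).integrable_indicator measurableSet_ball
  · filter_upwards [Measure.ae_ne volume (0 : Eucl n)] with y hy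
    have h1 : Tendsto (fun δ : ℝ => ψ (δ • y)) (𝓝[>] 0) (𝓝 (ψ 0)) := by
      have : Continuous fun δ : ℝ => ψ (δ • y) := hψ.continuous.comp (by fun_prop)
      simpa using (this.tendsto 0).mono_left nhdsWithin_le_nhds
    have h2 := ((ContinuousLinearMap.apply ℂ (Spinor n) φ).continuous.tendsto _).comp
      (hg.tendsto_scale hy)
    exact h1.inner ((((cliffordMul ε y).continuous.tendsto _).comp h2).const_smul _)

theorem tendsto_integral_cutoff {F : Eucl n → ℂ} [NeZero n] (hF : Integrable F) :
    Tendsto (fun δ : ℝ => ∫ x, Real.smoothTransition ((δ ^ 2)⁻¹ * ‖x‖ ^ 2 - 1) • F x)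
      (𝓝[>] 0) (𝓝 (∫ x, F x)) := by
  refine tendsto_integral_filter_of_dominated_convergence (fun x => ‖F x‖) ?_ ?_ hF.norm ?_
  · refine .of_forall fun δ => AEStronglyMeasurable.fun_smul ?_ hF.aestronglyMeasurable
    exact (Real.smoothTransition.continuous.comp (by fun_prop)).aestronglyMeasurable
  · refine .of_forall fun δ => .of_forall fun x => ?_
    rw [norm_smul, Real.norm_of_nonneg (Real.smoothTransition.nonneg _)]
    exact mul_le_of_le_one_left (norm_nonneg _) (Real.smoothTransition.le_one _)
  · filter_upwards [Measure.ae_ne volume (0 : Eucl n)] with x hx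
    refine tendsto_const_nhds.congr' ?_
    have hx0 : 0 < ‖x‖ := norm_pos_iff.2 hx
    filter_upwards [Ioo_mem_nhdsGT (half_pos hx0)] with δ hδ
    have h2 : 2 ≤ (δ ^ 2)⁻¹ * ‖x‖ ^ 2 := by
      rw [inv_mul_eq_div, le_div_iff₀ (by have := hδ.1; positivity)]
      nlinarith [hδ.1, hδ.2]
    rw [Real.smoothTransition.one_of_one_le (by linarith), one_smul]

/-- The cutoff integrals have two limits as `δ → 0`: the full integral, by dominated convergence,
and `⟨ψ(0), φ⟩`, by the annulus computation. -/
theorem integral_inner_eq (hg : IsDiracKernel ε l g) [NeZero n] {ψ : Eucl n → Spinor n}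
    (hψ : ContDiff ℝ 1 ψ) (hc : HasCompactSupport ψ) (φ : Spinor n) :
    Integrable (fun x => (inner ℂ (dirac ε ψ x - l • ψ x) (g x φ) : ℂ)) ∧
    ∫ x, (inner ℂ (dirac ε ψ x - l • ψ x) (g x φ) : ℂ) = inner ℂ (ψ 0) φ := by
  have hint : Integrable fun x => (inner ℂ (dirac ε ψ x - l • ψ x) (g x φ) : ℂ) := by
    refine hg.integrable_inner ((continuous_dirac ε hψ).sub (hψ.continuous.const_smul l)) ?_ φ
    have h := hc.comp_left (g := fun v : Spinor n => l • v) (smul_zero _)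
    exact (hasCompactSupport_dirac ε hc).sub h
  refine ⟨hint, tendsto_nhds_unique (tendsto_integral_cutoff hint) ?_⟩
  refine (hg.tendsto_integral_annulus hψ hc φ).congr' ?_
  filter_upwards [self_mem_nhdsWithin] with δ hδ
  exact (hg.integral_cutoff hψ hc φ hδ).symm

theorem isGreenFunction (hg : IsDiracKernel ε l g) [NeZero n] :
    IsGreenFunction ε l fun q => g (q.1 - q.2) where
  smooth := hg.smooth.comp (contDiff_fst.sub contDiff_snd).contDiffOn fun q hq =>
    sub_ne_zero.2 hq
  locallyIntegrable := locallyIntegrable_sub hg.locallyIntegrable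
  green := by
    intro p φ ψ hψ hc
    -- Translation invariance of `D` moves the pole from `p` to the origin.
    have hψ1 : ContDiff ℝ 1 fun x => ψ (x + p) :=
      (hψ.of_le (by exact_mod_cast le_top)).comp (contDiff_id.add contDiff_const)
    have hc1 : HasCompactSupport fun x => ψ (x + p) :=
      hc.comp_homeomorph (Homeomorph.addRight p)
    obtain ⟨hint, heq⟩ := hg.integral_inner_eq hψ1 hc1 φ
    have hdir : ∀ x, dirac ε (fun x => ψ (x + p)) x = dirac ε ψ (x + p) := fun x => by
      simp only [_root_.dirac_eq, fderiv_comp_add_right]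
    simp only [hdir, zero_add] at hint heq
    set F : Eucl n → ℂ := fun x => inner ℂ (dirac ε ψ x - l • ψ x) (g (x - p) φ) with hF
    have hFp : ∀ x, inner ℂ (dirac ε ψ (x + p) - l • ψ (x + p)) (g x φ) = F (x + p) := fun x => by
      simp only [hF, add_sub_cancel_right]
    simp only [hFp] at hint heq
    have hFint : Integrable F := by simpa using hint.comp_sub_right p
    rw [integral_add_right_eq_self F p] at heq
    rw [← heq]
    have hind : ∀ r : ℝ, ∫ x in (Metric.ball p r)ᶜ, F x
        = ∫ x, (Metric.ball p r)ᶜ.indicator F x := fun r =>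
      (integral_indicator measurableSet_ball.compl).symm
    change Tendsto (fun r : ℝ => ∫ x in (Metric.ball p r)ᶜ, F x) _ _
    simp only [hind]
    -- The full integrand is integrable, so excising shrinking balls does not change the limit.
    refine tendsto_integral_filter_of_dominated_convergence (fun x => ‖F x‖) ?_ ?_ hFint.norm ?_
    · exact .of_forall fun r => hFint.aestronglyMeasurable.indicator measurableSet_ball.compl
    · exact .of_forall fun r => .of_forall fun x => norm_indicator_le_norm_self _ _
    · filter_upwards [Measure.ae_ne volume p] with x hx
      refine tendsto_const_nhds.congr' ?_
      filter_upwards [Ioo_mem_nhdsGT (dist_pos.2 hx)] with r hr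
      rw [Set.indicator_of_mem]
      simpa using hr.2.le

end IsDiracKernel

/-! ### The explicit kernel. -/

section kernel

/-- The coefficients of the entire functions in front of `γ` in the Green's function. -/
noncomputable def scalarCoeff (n k : ℕ) : ℝ := (greenCoeff n (sphereVolume n) k).1

/-- The coefficients of the logarithmic part in front of `γ` in the Green's function. -/
noncomputable def scalarLogCoeff (n k : ℕ) : ℝ := (greenCoeff n (sphereVolume n) k).2

/-- The coefficients of the entire functions in front of `x · γ` in the Green's function. -/
noncomputable def vectorCoeff (n k : ℕ) : ℝ :=
  2 * ((1 - n / 2) * scalarCoeff n k + k * scalarCoeff n k + 2⁻¹ * scalarLogCoeff n k)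

/-- The coefficients of the logarithmic part in front of `x · γ` in the Green's function. -/
noncomputable def vectorLogCoeff (n k : ℕ) : ℝ :=
  2 * ((1 - n / 2) * scalarLogCoeff n k + k * scalarLogCoeff n k)

variable {n : ℕ}

theorem entireCoeff_scalar : EntireCoeff (scalarCoeff n) := entireCoeff_greenCoeff_fst

theorem entireCoeff_scalarLog : EntireCoeff (scalarLogCoeff n) := entireCoeff_greenCoeff_snd

theorem entireCoeff_vector : EntireCoeff (vectorCoeff n) :=
  (((entireCoeff_scalar.const_mul _).add entireCoeff_scalar.natMul).add
    (entireCoeff_scalarLog.const_mul _)).const_mul 2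

theorem entireCoeff_vectorLog : EntireCoeff (vectorLogCoeff n) :=
  ((entireCoeff_scalarLog.const_mul _).add entireCoeff_scalarLog.natMul).const_mul 2

theorem vectorCoeff_zero (hn : n ≠ 0) : vectorCoeff n 0 = -1 / sphereVolume n := by
  rw [← greenCoeff_leading (sphereVolume_pos hn).ne', vectorCoeff, scalarCoeff, scalarLogCoeff]
  push_cast
  ring

theorem vectorLogCoeff_eq (k : ℕ) :
    vectorLogCoeff n k = (2 * k + 2 - n) * scalarLogCoeff n k := by
  rw [vectorLogCoeff]
  ring

/-- No logarithm multiplies the leading singularity: for `n = 2` the factor `2 - n` vanishes,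
otherwise the initial logarithmic coefficient does. -/
theorem vectorLogCoeff_zero : vectorLogCoeff n 0 = 0 := by
  rw [← greenCoeff_zero_snd (n := n) (w := sphereVolume n), vectorLogCoeff_eq, scalarLogCoeff]
  push_cast
  ring

theorem vectorCoeff_succ (k : ℕ) :
    2 * ((k : ℝ) + 1) * vectorCoeff n (k + 1) + vectorLogCoeff n (k + 1) = -scalarCoeff n k := by
  have h := greenCoeff_fst_succ (n := n) (w := sphereVolume n) k
  rw [scalarCoeff, ← h, vectorLogCoeff, vectorCoeff, scalarCoeff, scalarLogCoeff]
  push_cast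
  ring

theorem vectorLogCoeff_succ (k : ℕ) :
    2 * ((k : ℝ) + 1) * vectorLogCoeff n (k + 1) = -scalarLogCoeff n k := by
  have h := greenCoeff_snd_succ (n := n) (w := sphereVolume n) k
  rw [scalarLogCoeff, ← h, vectorLogCoeff, scalarLogCoeff]
  push_cast
  ring

/-- The convolution kernel of the Green's function of `D - l`. -/
noncomputable def diracKernel (ε : ℤˣ) (l : ℝ) (x : Eucl n) : Spinor n →L[ℂ] Spinor n :=
  radialProfile (-(n / 2)) (vectorCoeff n) (vectorLogCoeff n) l (‖x‖ ^ 2) • cliffordMul ε x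
    + (l * radialProfile (1 - n / 2) (scalarCoeff n) (scalarLogCoeff n) l (‖x‖ ^ 2)) •
      ContinuousLinearMap.id ℂ (Spinor n)

variable (ε : ℤˣ) (l : ℝ)

theorem diracKernel_apply (x : Eucl n) (γ : Spinor n) :
    diracKernel ε l x γ
      = radialProfile (-(n / 2)) (vectorCoeff n) (vectorLogCoeff n) l (‖x‖ ^ 2) •
          cliffordMul ε x γ
        + (l * radialProfile (1 - n / 2) (scalarCoeff n) (scalarLogCoeff n) l (‖x‖ ^ 2)) • γ := rfl

/-- This is `2 s u' + n u = -l² v`. The operator `2 s d/ds + n` multiplies `s^(-n/2+k)` by `2k`, up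
to the term from the logarithm, so the `k = 0` coefficients disappear. The resulting index shift
produces `l²`, and the coefficient recursions identify the result. -/
theorem two_mul_deriv_vectorProfile {s : ℝ} (hs : 0 < s) :
    2 * (s * radialProfile (-(n / 2) - 1)
        (fun k => -(n / 2) * vectorCoeff n k + k * vectorCoeff n k + 2⁻¹ * vectorLogCoeff n k)
        (fun k => -(n / 2) * vectorLogCoeff n k + k * vectorLogCoeff n k) l s)
      + n * radialProfile (-(n / 2)) (vectorCoeff n) (vectorLogCoeff n) l s
      = -(l ^ 2 * radialProfile (1 - n / 2) (scalarCoeff n) (scalarLogCoeff n) l s) := by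
  have hU := entireCoeff_vector (n := n)
  have hW := entireCoeff_vectorLog (n := n)
  rw [mul_radialProfile hs, sub_add_cancel, ← radialProfile_const_mul, ← radialProfile_const_mul,
    ← radialProfile_add
      ((((hU.const_mul _).add hU.natMul).add (hW.const_mul _)).const_mul 2)
      (((hW.const_mul _).add hW.natMul).const_mul 2) (hU.const_mul _) (hW.const_mul _)]
  have e1 : (fun k : ℕ => 2 * (-(n / 2) * vectorCoeff n k + k * vectorCoeff n k
      + 2⁻¹ * vectorLogCoeff n k) + n * vectorCoeff n k)
      = fun k : ℕ => 2 * (k * vectorCoeff n k) + vectorLogCoeff n k := by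
    funext k
    ring
  have e2 : (fun k : ℕ => 2 * (-(n / 2) * vectorLogCoeff n k + k * vectorLogCoeff n k)
      + n * vectorLogCoeff n k) = fun k : ℕ => 2 * (k * vectorLogCoeff n k) := by
    funext k
    ring
  rw [e1, e2, radialProfile_shift ((hU.natMul.const_mul 2).add hW) (hW.natMul.const_mul 2)
    (by simp [vectorLogCoeff_zero]) (by simp) hs, ← mul_neg,
    neg_eq_neg_one_mul (radialProfile (1 - n / 2) _ _ _ _),
    ← radialProfile_const_mul (-1)]
  have e3 : (fun k : ℕ => 2 * (((k + 1 : ℕ) : ℝ) * vectorCoeff n (k + 1))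
      + vectorLogCoeff n (k + 1)) = fun k : ℕ => -1 * scalarCoeff n k := by
    funext k
    rw [← neg_eq_neg_one_mul, ← vectorCoeff_succ]
    push_cast
    ring
  have e4 : (fun k : ℕ => 2 * (((k + 1 : ℕ) : ℝ) * vectorLogCoeff n (k + 1)))
      = fun k : ℕ => -1 * scalarLogCoeff n k := by
    funext k
    rw [← neg_eq_neg_one_mul, ← vectorLogCoeff_succ]
    push_cast
    ring
  have e5 : -((n : ℝ) / 2) + 1 = 1 - n / 2 := by ring
  rw [e3, e4, e5]

theorem contDiff_cliffordMul_apply (γ : Spinor n) :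
    ContDiff ℝ ∞ fun x : Eucl n => cliffordMul ε x γ :=
  ContinuousLinearMap.contDiff
    ((ContinuousLinearMap.apply ℝ (Spinor n) γ).comp
        ((ContinuousLinearMap.restrictScalarsL ℂ (Spinor n) (Spinor n) ℝ ℝ).comp
          (cliffordCLM ε)))

theorem differentiableAt_comp_norm_sq {f : ℝ → ℝ} {f' : ℝ} {x : Eucl n}
    (hf : HasDerivAt f f' (‖x‖ ^ 2)) : DifferentiableAt ℝ (fun y : Eucl n => f (‖y‖ ^ 2)) x :=
  (hf.comp_hasFDerivAt x (hasStrictFDerivAt_norm_sq x).hasFDerivAt).differentiableAt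

/-- The `φ` component is `two_mul_deriv_vectorProfile`; the `x · φ` component is `2 v' = u`, which
holds by the definition of `vectorCoeff` and `vectorLogCoeff`. -/
theorem dirac_diracKernel (φ : Spinor n) {x : Eucl n} (hx : x ≠ 0) :
    dirac ε (fun y => diracKernel ε l y φ) x = l • diracKernel ε l x φ := by
  have hs : 0 < ‖x‖ ^ 2 := by positivity
  have hu := hasDerivAt_radialProfile (p := -(n / 2)) (l := l) (entireCoeff_vector (n := n))
    (entireCoeff_vectorLog (n := n)) hs
  have hv := (hasDerivAt_radialProfile (p := 1 - n / 2) (l := l) (entireCoeff_scalar (n := n))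
    (entireCoeff_scalarLog (n := n)) hs).const_mul l
  have hv2 : 2 * radialProfile (1 - n / 2 - 1)
      (fun k => (1 - n / 2) * scalarCoeff n k + k * scalarCoeff n k + 2⁻¹ * scalarLogCoeff n k)
      (fun k => (1 - n / 2) * scalarLogCoeff n k + k * scalarLogCoeff n k) l (‖x‖ ^ 2)
      = radialProfile (-(n / 2)) (vectorCoeff n) (vectorLogCoeff n) l (‖x‖ ^ 2) := by
    rw [← radialProfile_const_mul]
    have : (1 : ℝ) - n / 2 - 1 = -(n / 2) := by ring
    rw [this]
    rfl
  have hw := ((contDiff_cliffordMul_apply ε φ).differentiable (by simp)) x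
  have hd1 : DifferentiableAt ℝ (fun y : Eucl n =>
      radialProfile (-(n / 2)) (vectorCoeff n) (vectorLogCoeff n) l (‖y‖ ^ 2)) x :=
    differentiableAt_comp_norm_sq hu
  have hd2 : DifferentiableAt ℝ (fun y : Eucl n => l *
      radialProfile (1 - n / 2) (scalarCoeff n) (scalarLogCoeff n) l (‖y‖ ^ 2)) x :=
    differentiableAt_comp_norm_sq hv
  have h1 := dirac_radial_smul ε hu hw
  have h2 := dirac_radial_smul ε hv (differentiableAt_const φ)
  simp only [diracKernel_apply]
  rw [dirac_add ε (hd1.fun_smul hw) (hd2.fun_smul (differentiableAt_const φ)), h1, h2,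
    dirac_cliffordMul, dirac_const, smul_zero, add_zero, cliffordMul_sq]
  have hc : ((-(‖x‖ ^ 2 : ℝ) : ℂ)) • φ = (-(‖x‖ ^ 2)) • φ := by
    rw [← Complex.coe_smul]
    push_cast
    rfl
  rw [hc, ← mul_assoc, mul_comm 2 l, mul_assoc, hv2]
  have hkey := two_mul_deriv_vectorProfile (n := n) l hs
  have hl : l * (l * radialProfile (1 - n / 2) (scalarCoeff n) (scalarLogCoeff n) l (‖x‖ ^ 2))
      = -(2 * (‖x‖ ^ 2 * radialProfile (-(n / 2) - 1)
        (fun k => -(n / 2) * vectorCoeff n k + k * vectorCoeff n k + 2⁻¹ * vectorLogCoeff n k)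
        (fun k => -(n / 2) * vectorLogCoeff n k + k * vectorLogCoeff n k) l (‖x‖ ^ 2))
      + n * radialProfile (-(n / 2)) (vectorCoeff n) (vectorLogCoeff n) l (‖x‖ ^ 2)) := by
    rw [hkey]
    ring
  rw [smul_add, smul_smul l (l * _), hl]
  module

theorem radialProfile_norm_sq {c d : ℕ → ℝ} {x : Eucl n} (hx : x ≠ 0) :
    radialProfile (-(n / 2)) c d l (‖x‖ ^ 2)
      = (‖x‖ ^ n)⁻¹ * (powSum c (l ^ 2 * ‖x‖ ^ 2)
        + Real.log ‖x‖ * powSum d (l ^ 2 * ‖x‖ ^ 2)) := by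
  rw [radialProfile, Real.log_pow, Real.rpow_neg (by positivity), ← Real.rpow_natCast_mul
    (norm_nonneg x)]
  have : ((2 : ℕ) : ℝ) * (n / 2) = n := by push_cast; ring
  rw [this, Real.rpow_natCast]
  push_cast
  ring

theorem diracKernel_apply_of_ne {x : Eucl n} (hx : x ≠ 0) (γ : Spinor n) :
    diracKernel ε l x γ
      = ((‖x‖ ^ n)⁻¹ * (powSum (vectorCoeff n) (l ^ 2 * ‖x‖ ^ 2)
          + Real.log ‖x‖ * powSum (vectorLogCoeff n) (l ^ 2 * ‖x‖ ^ 2))) • cliffordMul ε x γ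
        + (l * (‖x‖ ^ 2 * ((‖x‖ ^ n)⁻¹ * (powSum (scalarCoeff n) (l ^ 2 * ‖x‖ ^ 2)
          + Real.log ‖x‖ * powSum (scalarLogCoeff n) (l ^ 2 * ‖x‖ ^ 2))))) • γ := by
  have e : (1 : ℝ) - n / 2 = -(n / 2) + 1 := by ring
  rw [diracKernel_apply, e, ← mul_radialProfile (by positivity), radialProfile_norm_sq l hx,
    radialProfile_norm_sq l hx]

theorem isDiracKernel_diracKernel (hn : n ≠ 0) :
    IsDiracKernel ε l (diracKernel (n := n) ε l) where
  smooth := by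
    intro x hx
    have hs : ‖x‖ ^ 2 ≠ 0 := pow_ne_zero 2 (norm_ne_zero_iff.2 hx)
    have hsq : ContDiffAt ℝ ∞ (fun y : Eucl n => ‖y‖ ^ 2) x := (contDiff_norm_sq ℝ).contDiffAt
    have h1 := (contDiffAt_radialProfile (p := -(n / 2)) (l := l) (entireCoeff_vector (n := n))
      (entireCoeff_vectorLog (n := n)) hs).comp x hsq
    have h2 := (contDiffAt_radialProfile (p := 1 - n / 2) (l := l) (entireCoeff_scalar (n := n))
      (entireCoeff_scalarLog (n := n)) hs).comp x hsq
    exact ((h1.smul (cliffordCLM ε).contDiff.contDiffAt).add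
      ((contDiffAt_const.mul h2).smul contDiffAt_const)).contDiffWithinAt
  leading := by
    -- `c₁` and `c₂` are the components of the rescaled remainder along `(x/|x|) ·` and the
    -- identity. Logarithms enter only through `|x| log |x|`, so both extend continuously by zero to
    -- the origin; for `c₁` this uses `vectorLogCoeff_zero`.
    set c₁ : Eucl n → ℝ := fun x => powSum (vectorCoeff n) (l ^ 2 * ‖x‖ ^ 2) + 1 / sphereVolume n
      + (‖x‖ * Real.log ‖x‖) *
        (l ^ 2 * ‖x‖ * powSum (fun k => vectorLogCoeff n (k + 1)) (l ^ 2 * ‖x‖ ^ 2)) with hc₁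
    set c₂ : Eucl n → ℝ := fun x => l * (‖x‖ * powSum (scalarCoeff n) (l ^ 2 * ‖x‖ ^ 2)
      + (‖x‖ * Real.log ‖x‖) * powSum (scalarLogCoeff n) (l ^ 2 * ‖x‖ ^ 2)) with hc₂
    have hlog : Continuous fun x : Eucl n => ‖x‖ * Real.log ‖x‖ :=
      Real.continuous_mul_log.comp continuous_norm
    have hps : ∀ {c : ℕ → ℝ}, EntireCoeff c →
        Continuous fun x : Eucl n => powSum c (l ^ 2 * ‖x‖ ^ 2) := fun hc =>
      hc.continuous.comp (by fun_prop)
    have hcont₁ : Continuous c₁ := ((hps entireCoeff_vector).add continuous_const).add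
      (hlog.mul ((continuous_const.mul continuous_norm).mul
        (hps (entireCoeff_vectorLog.shift 1))))
    have hcont₂ : Continuous c₂ := continuous_const.mul
      ((continuous_norm.mul (hps entireCoeff_scalar)).add (hlog.mul (hps entireCoeff_scalarLog)))
    have h₁ : Tendsto c₁ (𝓝[≠] 0) (𝓝 0) := by
      have h0 : c₁ 0 = 0 := by
        simp only [hc₁, norm_zero, zero_mul, add_zero, ne_eq, OfNat.ofNat_ne_zero,
          not_false_eq_true, zero_pow, mul_zero, EntireCoeff.powSum_zero, vectorCoeff_zero hn]
        ring
      have := (hcont₁.tendsto 0).mono_left (nhdsWithin_le_nhds (s := {0}ᶜ))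
      rwa [h0] at this
    have h₂ : Tendsto c₂ (𝓝[≠] 0) (𝓝 0) := by
      have h0 : c₂ 0 = 0 := by simp [hc₂]
      have := (hcont₂.tendsto 0).mono_left (nhdsWithin_le_nhds (s := {0}ᶜ))
      rwa [h0] at this
    have hsum : Tendsto (fun x => |c₁ x| + |c₂ x|) (𝓝[≠] 0) (𝓝 0) := by
      simpa using h₁.abs.add h₂.abs
    refine squeeze_zero_norm' ?_ hsum
    filter_upwards [self_mem_nhdsWithin] with x hx
    have hx : x ≠ 0 := hx
    have hr : ‖x‖ ≠ 0 := norm_ne_zero_iff.2 hx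
    have hrn : ‖x‖ ^ n = ‖x‖ ^ (n - 1) * ‖x‖ := (pow_sub_one_mul hn _).symm
    refine ContinuousLinearMap.opNorm_le_bound _ (by positivity) fun φ => ?_
    have heq : (‖x‖ ^ (n - 1) • diracKernel ε l x
          + (1 / sphereVolume n) • cliffordMul ε (‖x‖⁻¹ • x)) φ
        = c₁ x • cliffordMul ε (‖x‖⁻¹ • x) φ + c₂ x • φ := by
      rw [add_apply, smul_apply, smul_apply,
        diracKernel_apply_of_ne ε l hx, cliffordMul_smul, smul_apply, hc₁, hc₂,
        entireCoeff_vectorLog.powSum_eq_add, vectorLogCoeff_zero, hrn]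
      simp only
      have hp := pow_ne_zero (n - 1) hr
      generalize ‖x‖ ^ (n - 1) = q at *
      rw [smul_add, smul_smul, smul_smul, smul_smul, smul_smul, add_right_comm, ← add_smul]
      congr 2
      · field_simp
        ring
      · field_simp
    rw [heq]
    refine (norm_add_le _ _).trans ?_
    rw [norm_smul, norm_smul, norm_cliffordMul_apply, norm_smul, norm_inv, norm_norm,
      inv_mul_cancel₀ hr, one_mul, add_mul]
    rfl
  dirac_eq := fun φ x hx => dirac_diracKernel ε l φ hx

end kernel

/-! ### Expansion at the origin and the remainder spinors. -/

section expansion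

variable {n : ℕ} (ε : ℤˣ)

/-- Entire power series in `l` of the shape of the remainder terms in the expansion of
`diracKernel`: `l ^ j (c(l² |x|²) x · γ + l |x|² d(l² |x|²) γ)`. -/
noncomputable def remainderSpinor (j : ℕ) (c d : ℕ → ℝ) (γ : Spinor n) (l : ℝ) (x : Eucl n) :
    Spinor n :=
  l ^ j • (powSum c (l ^ 2 * ‖x‖ ^ 2) • cliffordMul ε x γ
    + l • (powSum d (l ^ 2 * ‖x‖ ^ 2) • (‖x‖ ^ 2 • γ)))

variable {j : ℕ} {c d : ℕ → ℝ} (γ : Spinor n) (l : ℝ)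

theorem contDiff_remainderSpinor (hc : EntireCoeff c) (hd : EntireCoeff d) :
    ContDiff ℝ ∞ (remainderSpinor ε j c d γ l) := by
  have hsq : ContDiff ℝ ∞ fun x : Eucl n => ‖x‖ ^ 2 := contDiff_norm_sq ℝ
  have h : ContDiff ℝ ∞ fun x : Eucl n => l ^ 2 * ‖x‖ ^ 2 := contDiff_const.mul hsq
  exact (((hc.contDiff.comp h).smul (contDiff_cliffordMul_apply ε γ)).add
    (((hd.contDiff.comp h).smul (hsq.smul contDiff_const)).const_smul l)).const_smul (l ^ j)

theorem remainderSpinor_zero : remainderSpinor ε j c d γ l 0 = 0 := by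
  have : cliffordMul ε (0 : Eucl n) = 0 := (cliffordCLM ε).map_zero
  simp [remainderSpinor, this]

/-- A differentiable map vanishing at the origin is `O(|x|)`. -/
theorem isBigO_remainderSpinor (hc : EntireCoeff c) (hd : EntireCoeff d) :
    (fun x => ‖remainderSpinor ε j c d γ l x‖) =O[𝓝 0] fun x : Eucl n => ‖x‖ := by
  have h := ((contDiff_remainderSpinor ε (j := j) γ l hc hd).differentiable (by simp)
    0).isBigO_sub
  simp only [remainderSpinor_zero, sub_zero] at h
  exact h.norm_norm

theorem isEntireSeries_remainderSpinor (hc : EntireCoeff c) (hd : EntireCoeff d) (x : Eucl n) :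
    IsEntireSeries fun l => remainderSpinor ε j c d γ l x :=
  ((IsEntireSeries.powSum_smul hc _ _).add
    (IsEntireSeries.powSum_smul hd _ _).param_smul).param_pow_smul j

theorem remainderSpinor_param_zero (hj : j ≠ 0) (x : Eucl n) :
    remainderSpinor ε j c d γ 0 x = 0 := by
  simp [remainderSpinor, hj]

/-- The remainder in front of `|x| ^ (2 - n)`. -/
noncomputable def powerRemainder (γ : Spinor n) : ℝ → Eucl n → Spinor n :=
  remainderSpinor ε 2 (fun k => vectorCoeff n (k + 1)) (fun k => scalarCoeff n (k + 1)) γ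

/-- The remainder in front of `log |x|`. -/
noncomputable def logRemainder (γ : Spinor n) : ℝ → Eucl n → Spinor n :=
  remainderSpinor ε n (fun k => vectorLogCoeff n (k + n / 2))
    (fun k => scalarLogCoeff n (k + n / 2)) γ

/-- The logarithmic part of the Green's function for even `n`. -/
theorem log_part_of_even {m : ℕ} (hm : n = 2 * m + 2) {x : Eucl n} (hx : x ≠ 0) :
    ((‖x‖ ^ n)⁻¹ * powSum (vectorLogCoeff n) (l ^ 2 * ‖x‖ ^ 2)) • cliffordMul ε x γ
      + (l * (‖x‖ ^ 2 * ((‖x‖ ^ n)⁻¹ * powSum (scalarLogCoeff n) (l ^ 2 * ‖x‖ ^ 2)))) • γ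
      = (l ^ (n - 1) * scalarLogCoeff n m) • γ + logRemainder ε γ l x := by
  have hr : ‖x‖ ≠ 0 := norm_ne_zero_iff.2 hx
  have hdiv : n / 2 = m + 1 := by omega
  have hpow : ∀ r : ℝ, r ^ n = r ^ (2 * m) * r ^ 2 := fun r => by rw [hm, pow_add]
  have hb : ∀ k < m, scalarLogCoeff n k = 0 := fun k hk => greenCoeff_snd_eq_zero (by omega)
  -- The vector series starts one index later than the scalar one: at `k = m` the factor `2k + 2 -
  -- n` vanishes.
  have hW : ∀ k < m + 1, vectorLogCoeff n k = 0 := fun k hk => by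
    rw [vectorLogCoeff_eq]
    rcases eq_or_lt_of_le (Nat.lt_succ_iff.1 hk) with rfl | h
    · rw [hm]
      push_cast
      ring
    · rw [hb k h, mul_zero]
  have e1 : (‖x‖ ^ n)⁻¹ * powSum (vectorLogCoeff n) (l ^ 2 * ‖x‖ ^ 2)
      = l ^ n * powSum (fun k => vectorLogCoeff n (k + n / 2)) (l ^ 2 * ‖x‖ ^ 2) := by
    rw [entireCoeff_vectorLog.powSum_eq_pow_mul hW, hdiv]
    have : (l ^ 2 * ‖x‖ ^ 2) ^ (m + 1) = l ^ n * ‖x‖ ^ n := by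
      rw [hpow, hpow]
      ring
    rw [this]
    field_simp
  -- Only the `k = m` term survives outside the remainder; its factor `l * l ^ (2 * m)` is `l ^ (n -
  -- 1)`, and the powers of `|x|` cancel.
  have e2 : l * (‖x‖ ^ 2 * ((‖x‖ ^ n)⁻¹ * powSum (scalarLogCoeff n) (l ^ 2 * ‖x‖ ^ 2)))
      = l ^ (n - 1) * scalarLogCoeff n m
        + l ^ n * l * powSum (fun k => scalarLogCoeff n (k + n / 2)) (l ^ 2 * ‖x‖ ^ 2)
          * ‖x‖ ^ 2 := by
    rw [entireCoeff_scalarLog.powSum_eq_pow_mul hb, (entireCoeff_scalarLog.shift m).powSum_eq_add,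
      hdiv]
    have h3 : l ^ (n - 1) = l ^ (2 * m) * l := by rw [hm]; rfl
    have h4 : (fun k => scalarLogCoeff n (k + 1 + m)) = fun k => scalarLogCoeff n (k + (m + 1)) := by
      funext k
      rw [add_assoc, add_comm 1 m]
    rw [hpow, hpow, h3, h4, mul_pow, ← pow_mul, ← pow_mul, zero_add]
    field_simp
  rw [e1, e2, logRemainder, remainderSpinor]
  module

theorem scalarLogCoeff_of_odd (hn : Odd n) : scalarLogCoeff n = 0 :=
  funext fun k => greenCoeff_snd_eq_zero_of_odd hn k

theorem vectorLogCoeff_of_odd (hn : Odd n) : vectorLogCoeff n = 0 :=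
  funext fun k => by rw [vectorLogCoeff_eq, scalarLogCoeff_of_odd hn]; simp

theorem scalarLogCoeff_critical {m : ℕ} (hm : n = 2 * m + 2) :
    scalarLogCoeff n m
      = -(1 / (2 ^ (n - 2) * Real.Gamma ((n : ℝ) / 2) ^ 2 * sphereVolume n)) := by
  subst hm
  rw [scalarLogCoeff, greenCoeff_snd_critical (sphereVolume_pos (by omega)).ne']
  have h1 : (((2 * m + 2 : ℕ) : ℝ)) / 2 = m + 1 := by push_cast; ring
  rw [h1, Real.Gamma_nat_eq_factorial, Nat.add_sub_cancel, pow_mul]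
  norm_num

/-- The power part of the Green's function. -/
theorem power_part (hn : 2 ≤ n) {x : Eucl n} (hx : x ≠ 0) :
    ((‖x‖ ^ n)⁻¹ * powSum (vectorCoeff n) (l ^ 2 * ‖x‖ ^ 2)) • cliffordMul ε x γ
      + (l * (‖x‖ ^ 2 * ((‖x‖ ^ n)⁻¹ * powSum (scalarCoeff n) (l ^ 2 * ‖x‖ ^ 2)))) • γ
      = -(1 / (sphereVolume n * ‖x‖ ^ (n - 1))) • cliffordMul ε (‖x‖⁻¹ • x) γ
        + (l * scalarCoeff n 0 * (‖x‖ ^ (n - 2))⁻¹) • γ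
        + ‖x‖ ^ ((2 : ℤ) - (n : ℤ)) • powerRemainder ε γ l x := by
  have hr : ‖x‖ ≠ 0 := norm_ne_zero_iff.2 hx
  have hω : sphereVolume n ≠ 0 := (sphereVolume_pos (by omega)).ne'
  have hz : ‖x‖ ^ ((2 : ℤ) - (n : ℤ)) = (‖x‖ ^ (n - 2))⁻¹ := by
    rw [← zpow_natCast, ← zpow_neg]
    congr 1
    omega
  have h1 : ‖x‖ ^ n = ‖x‖ ^ (n - 2) * ‖x‖ ^ 2 := by rw [← pow_add]; congr 1; omega
  have h2 : ‖x‖ ^ (n - 1) = ‖x‖ ^ (n - 2) * ‖x‖ := by rw [← pow_succ]; congr 1; omega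
  rw [entireCoeff_vector.powSum_eq_add, entireCoeff_scalar.powSum_eq_add,
    vectorCoeff_zero (by omega), cliffordMul_smul, smul_apply, hz, h1, h2, powerRemainder,
    remainderSpinor]
  have hq : ‖x‖ ^ (n - 2) ≠ 0 := pow_ne_zero _ hr
  generalize ‖x‖ ^ (n - 2) = q at *
  generalize powSum (fun k => vectorCoeff n (k + 1)) (l ^ 2 * ‖x‖ ^ 2) = U
  generalize powSum (fun k => scalarCoeff n (k + 1)) (l ^ 2 * ‖x‖ ^ 2) = A
  -- The `k = 0` coefficient gives the singular term; the shifted series has a factor `l ^ 2 * ‖x‖ ^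
  -- 2`, turning `|x|^(-n)` into `|x|^(2-n)`.
  have e1 : (q * ‖x‖ ^ 2)⁻¹ * (-1 / sphereVolume n + l ^ 2 * ‖x‖ ^ 2 * U)
      = -(1 / (sphereVolume n * (q * ‖x‖))) * ‖x‖⁻¹ + q⁻¹ * l ^ 2 * U := by
    field_simp
  have e2 : l * (‖x‖ ^ 2 * ((q * ‖x‖ ^ 2)⁻¹ * (scalarCoeff n 0 + l ^ 2 * ‖x‖ ^ 2 * A)))
      = l * scalarCoeff n 0 * q⁻¹ + q⁻¹ * l ^ 2 * l * A * ‖x‖ ^ 2 := by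
    field_simp
  rw [e1, e2]
  module

theorem diracKernel_eq_power_add_log {x : Eucl n} (hx : x ≠ 0) :
    diracKernel ε l x γ
      = (((‖x‖ ^ n)⁻¹ * powSum (vectorCoeff n) (l ^ 2 * ‖x‖ ^ 2)) • cliffordMul ε x γ
        + (l * (‖x‖ ^ 2 * ((‖x‖ ^ n)⁻¹ * powSum (scalarCoeff n) (l ^ 2 * ‖x‖ ^ 2)))) • γ)
      + Real.log ‖x‖ •
        (((‖x‖ ^ n)⁻¹ * powSum (vectorLogCoeff n) (l ^ 2 * ‖x‖ ^ 2)) • cliffordMul ε x γ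
        + (l * (‖x‖ ^ 2 * ((‖x‖ ^ n)⁻¹ * powSum (scalarLogCoeff n) (l ^ 2 * ‖x‖ ^ 2)))) • γ) := by
  rw [diracKernel_apply_of_ne ε l hx]
  module

theorem scalarCoeff_zero_of_three_le (hn : 3 ≤ n) :
    scalarCoeff n 0 = 1 / (((n : ℝ) - 2) * sphereVolume n) := by
  rw [scalarCoeff, greenCoeff, if_neg (by omega)]

theorem sphereVolume_two : sphereVolume 2 = 2 * Real.pi := by
  rw [sphereVolume_eq, measureReal_def, EuclideanSpace.volume_ball_fin_two]
  simp [Real.pi_nonneg]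

end expansion

/-! ### Assembly of the main theorem. -/

theorem mainTheorem7 (n : ℕ) (hn : 2 ≤ n) (ε : ℤˣ) :
    ∃ G : ℝ → Eucl n × Eucl n → (Spinor n →L[ℂ] Spinor n),
      (∀ lam : ℝ, IsGreenFunction ε lam (G lam)) ∧
      ∀ γ : Spinor n, ∃ ϑ ζ : ℝ → Eucl n → Spinor n,
        -- the remainder spinors are smooth on the whole space and vanish to first order at 0
        (∀ lam : ℝ, ContDiff ℝ ∞ (ϑ lam) ∧ ContDiff ℝ ∞ (ζ lam) ∧
          (fun x => ‖ϑ lam x‖) =O[𝓝 0] (fun x : Eucl n => ‖x‖) ∧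
          (fun x => ‖ζ lam x‖) =O[𝓝 0] (fun x : Eucl n => ‖x‖)) ∧
        -- for fixed x they are convergent power series in lam without constant term
        (∀ x : Eucl n,
          (∃ a : ℕ → Spinor n, ∀ lam : ℝ, HasSum (fun k : ℕ => lam ^ k • a k) (ϑ lam x)) ∧
          (∃ b : ℕ → Spinor n, ∀ lam : ℝ, HasSum (fun k : ℕ => lam ^ k • b k) (ζ lam x)) ∧
          ϑ 0 x = 0 ∧ ζ 0 x = 0) ∧
        (n = 2 → ∀ (lam : ℝ) (x : Eucl n), x ≠ 0 →
          G lam (x, 0) γ =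
            -(1 / (2 * Real.pi * ‖x‖)) • cliffordMul ε (‖x‖⁻¹ • x) γ
            - (lam / (2 * Real.pi) * Real.log ‖x‖) • γ
            + Real.log ‖x‖ • ϑ lam x + ζ lam x) ∧
        (Odd n → 3 ≤ n → ∀ (lam : ℝ) (x : Eucl n), x ≠ 0 →
          G lam (x, 0) γ =
            -(1 / (sphereVolume n * ‖x‖ ^ (n - 1))) • cliffordMul ε (‖x‖⁻¹ • x) γ
            + (lam / (((n : ℝ) - 2) * sphereVolume n * ‖x‖ ^ (n - 2))) • γ
            + ‖x‖ ^ ((2 : ℤ) - (n : ℤ)) • ζ lam x) ∧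
        (Even n → 4 ≤ n → ∀ (lam : ℝ) (x : Eucl n), x ≠ 0 →
          G lam (x, 0) γ =
            -(1 / (sphereVolume n * ‖x‖ ^ (n - 1))) • cliffordMul ε (‖x‖⁻¹ • x) γ
            + (lam / (((n : ℝ) - 2) * sphereVolume n * ‖x‖ ^ (n - 2))) • γ
            + ‖x‖ ^ ((2 : ℤ) - (n : ℤ)) • ζ lam x
            - (lam ^ (n - 1) /
                (2 ^ (n - 2) * Real.Gamma ((n : ℝ) / 2) ^ 2 * sphereVolume n)
                * Real.log ‖x‖) • γ
            + Real.log ‖x‖ • ϑ lam x) := by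
  have hn0 : n ≠ 0 := by omega
  have : NeZero n := ⟨hn0⟩
  have hc1 := (entireCoeff_vector (n := n)).shift 1
  have hd1 := (entireCoeff_scalar (n := n)).shift 1
  have hc2 := (entireCoeff_vectorLog (n := n)).shift (n / 2)
  have hd2 := (entireCoeff_scalarLog (n := n)).shift (n / 2)
  refine ⟨fun l q => diracKernel ε l (q.1 - q.2), fun l =>
    (isDiracKernel_diracKernel ε l hn0).isGreenFunction, fun γ =>
    ⟨logRemainder ε γ, powerRemainder ε γ, fun l => ⟨contDiff_remainderSpinor ε γ l hc2 hd2,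
      contDiff_remainderSpinor ε γ l hc1 hd1, isBigO_remainderSpinor ε γ l hc2 hd2,
      isBigO_remainderSpinor ε γ l hc1 hd1⟩, fun x =>
      ⟨isEntireSeries_remainderSpinor ε γ hc2 hd2 x, isEntireSeries_remainderSpinor ε γ hc1 hd1 x,
        remainderSpinor_param_zero ε γ hn0 x, remainderSpinor_param_zero ε γ two_ne_zero x⟩,
      ?_, ?_, ?_⟩⟩
  · intro h2 l x hx
    subst h2
    simp only [sub_zero]
    rw [diracKernel_eq_power_add_log ε γ l hx, power_part ε γ l hn hx,
      log_part_of_even ε γ l (m := 0) rfl hx, sphereVolume_two, scalarLogCoeff_critical (m := 0) rfl,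
      sphereVolume_two]
    -- In dimension two the critical index is `0`, so the `λ` term comes from the logarithmic part
    -- and the power part contributes none.
    have ha : scalarCoeff 2 0 = 0 := by rw [scalarCoeff, greenCoeff, if_pos rfl]
    rw [ha]
    norm_num
    module
  · intro hodd h3 l x hx
    simp only [sub_zero]
    -- In odd dimensions both logarithmic series vanish identically.
    have h0 : ∀ t, powSum (0 : ℕ → ℝ) t = 0 := fun t => by simp [powSum]
    rw [diracKernel_eq_power_add_log ε γ l hx, power_part ε γ l hn hx, vectorLogCoeff_of_odd hodd,
      scalarLogCoeff_of_odd hodd, h0, scalarCoeff_zero_of_three_le h3]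
    simp only [mul_zero, zero_smul, add_zero, smul_zero]
    congr 3
    rw [mul_one_div, ← div_eq_mul_inv, div_div]
  · intro heven h4 l x hx
    simp only [sub_zero]
    obtain ⟨m, hm⟩ : ∃ m, n = 2 * m + 2 := by
      obtain ⟨k, hk⟩ := heven
      exact ⟨k - 1, by omega⟩
    rw [diracKernel_eq_power_add_log ε γ l hx, power_part ε γ l hn hx,
      log_part_of_even ε γ l hm hx, scalarLogCoeff_critical hm,
      scalarCoeff_zero_of_three_le (by omega)]
    have e1 : l * (1 / (((n : ℝ) - 2) * sphereVolume n)) * (‖x‖ ^ (n - 2))⁻¹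
        = l / (((n : ℝ) - 2) * sphereVolume n * ‖x‖ ^ (n - 2)) := by
      rw [mul_one_div, ← div_eq_mul_inv, div_div]
    rw [e1]
    generalize 2 ^ (n - 2) * Real.Gamma ((n : ℝ) / 2) ^ 2 * sphereVolume n = D
    rw [div_eq_mul_one_div (l ^ (n - 1)) D]
    module
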